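/- **Extensionality for closed terms of the Beta-Bernoulli theory.** *Terms.* A parameter context $\Gamma=(p_1,\dots,p_\ell)$ is a finite list of distinct parameters, and a variable context $\Delta=(x_1\colon m_1,\dots,x_k\colon m_k)$ is a finite list of distinct variables with arities $m_i\in\mathbb N$. Terms in context, written $\Gamma\mid\Delta\vdash t$ and taken up to $\alpha$-conversion, are generated by the following rules: - $\Gamma\mid\Delta\vdash x(p_1,\dots,p_m)$ if $(x\colon m)\in\Delta$ and $p_1,\dots,p_m\in\Gamma$ (not necessarily distinct); - $\Gamma\mid\Delta\vdash \nu_{i,j}p.\,t$ if $\Gamma,p\mid\Delta\vdash t$, for integers $i,j>0$ (this binds $p$ in $t$); - $\Gamma\mid\Delta\vdash t\mathbin{?_p}u$ if $p\in\Gamma$ and $\Gamma\mid\Delta\vdash t,u$; - $\Gamma\mid\Delta\vdash t\mathbin{{}_i?_j}u$ if $\Gamma\mid\Delta\vdash t,u$, for $i,j\in\mathbb N$ with $i+j>0$. *Equations.* Derivable equality $\Gamma\mid\Delta\vdash t=u$ is the closure, under capture-avoiding substitution (of parameters for parameters, possibly identifying some of them, and of terms with formal parameters for variables), congruence, reflexivity,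 symmetry and transitivity, of the following axioms, for all indices for which both sides are terms: - (rational convexity; $\Gamma$ empty, $w,x,y,z\colon 0$) $(w\mathbin{{}_i?_j}x)\mathbin{{}_{i+j}?_{k+l}}(y\mathbin{{}_k?_l}z)=(w\mathbin{{}_i?_k}y)\mathbin{{}_{i+k}?_{j+l}}(x\mathbin{{}_j?_l}z)$, $\;x\mathbin{{}_i?_j}y=y\mathbin{{}_j?_i}x$, $\;x\mathbin{{}_i?_0}y=x$, $\;x\mathbin{{}_i?_j}x=x$; - (commutativity) $(w\mathbin{?_q}x)\mathbin{?_p}(y\mathbin{?_q}z)=(w\mathbin{?_p}y)\mathbin{?_q}(x\mathbin{?_p}z)$; $\;\nu_{i,j}p.\nu_{k,l}q.\,x(p,q)=\nu_{k,l}q.\nu_{i,j}p.\,x(p,q)$; $\;\nu_{i,j}p.(x(p)\mathbin{?_q}y(p))=(\nu_{i,j}p.x(p))\mathbin{?_q}(\nu_{i,j}p.y(p))$; $\;\nu_{i,j}p.(x(p)\mathbin{{}_k?_l}y(p))=(\nu_{i,j}p.x(p))\mathbin{{}_k?_l}(\nu_{i,j}p.y(p))$; $\;(w\mathbin{{}_i?_j}x)\mathbin{?_p}(y\mathbin{{}_i?_j}z)=(w\mathbin{?_p}y)\mathbin{{}_i?_j}(x\mathbin{?_p}z)$;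 - (discardability) $\nu_{i,j}p.\,x=x$ and $x\mathbin{?_p}x=x$, for $x\colon 0$; - (conjugacy) $\nu_{i,j}p.(x(p)\mathbin{?_p}y(p))=(\nu_{i+1,j}p.x(p))\mathbin{{}_i?_j}(\nu_{i,j+1}p.y(p))$. *Proposition.* Let $\Gamma,q\mid\Delta\vdash t$ and $\Gamma,q\mid\Delta\vdash u$. If $\Gamma\mid\Delta\vdash \nu_{i,j}q.\,t=\nu_{i,j}q.\,u$ is derivable for all integers $i,j>0$, then $\Gamma,q\mid\Delta\vdash t=u$ is derivable. -/

import Mathlib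

namespace BetaBernoulli

/-- Raw syntax of the Beta-Bernoulli theory, well scoped and up to `α`-conversion (de Bruijn).
A context `Δ = (x₁ : m₁, …, x_k : m_k)` is the function `Δ : Fin k → ℕ` of arities, and a parameter
context with `n` parameters is represented by `Fin n`, so `Term Δ n` is the set of terms
`Γ ∣ Δ ⊢ t` with `n` parameters in `Γ`. The binder `ν` extends `Γ` by one parameter, which gets
index `0`, while the parameters already in `Γ` are shifted by `Fin.succ`. -/
inductive Term {k : ℕ} (Δ : Fin k → ℕ) : ℕ → Type
  /-- `x(p₁, …, p_m)` for a variable `x : m` -/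
  | var {n : ℕ} (x : Fin k) (ps : Fin (Δ x) → Fin n) : Term Δ n
  /-- `ν_{i,j} q. t`, with `i, j > 0` -/
  | nu {n : ℕ} (i j : ℕ) (hi : 0 < i) (hj : 0 < j) (t : Term Δ (n + 1)) : Term Δ n
  /-- `t ?_p u` -/
  | get {n : ℕ} (p : Fin n) (t u : Term Δ n) : Term Δ n
  /-- `t ᵢ?ⱼ u`, with `i + j > 0` -/
  | choice {n : ℕ} (i j : ℕ) (h : 0 < i + j) (t u : Term Δ n) : Term Δ n

/-- Extension of a renaming of parameters under a binder: the bound parameter is fixed. -/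
def liftRen {n n' : ℕ} (ρ : Fin n → Fin n') : Fin (n + 1) → Fin (n' + 1) :=
  Fin.cons 0 (fun p => (ρ p).succ)

/-- Capture-avoiding renaming of the free parameters of a term. -/
def Term.rename {k : ℕ} {Δ : Fin k → ℕ} :
    {n : ℕ} → Term Δ n → {n' : ℕ} → (Fin n → Fin n') → Term Δ n'
  | _, .var x ps, _, ρ => .var x (fun a => ρ (ps a))
  | _, .nu i j hi hj t, _, ρ => .nu i j hi hj (t.rename (liftRen ρ))
  | _, .get p t u, _, ρ => .get (ρ p) (t.rename ρ) (u.rename ρ)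
  | _, .choice i j h t u, _, ρ => .choice i j h (t.rename ρ) (u.rename ρ)

/-- Capture-avoiding simultaneous substitution: parameters are replaced along `ρ` (which may
identify parameters), and each variable `x : m` of `Δ` is replaced by the term `σ x` over `Δ'`.
The first `m` parameters of `σ x` are its formal parameters, which are instantiated by the arguments
of `x`; its other parameters are free parameters from the target context. -/
def Term.subst {k k' : ℕ} {Δ : Fin k → ℕ} {Δ' : Fin k' → ℕ} :
    {n : ℕ} → Term Δ n → {n' : ℕ} → (Fin n → Fin n') →
      ((x : Fin k) → Term Δ' (Δ x + n')) → Term Δ' n'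
  | _, .var x ps, _, ρ, σ => (σ x).rename (Fin.append (fun a => ρ (ps a)) id)
  | _, .nu i j hi hj t, n', ρ, σ =>
      .nu i j hi hj (t.subst (liftRen ρ) (fun x => (σ x).rename
        (Fin.append (Fin.castAdd (n' + 1)) (fun p : Fin n' => Fin.natAdd (Δ x) p.succ))))
  | _, .get p t u, _, ρ, σ => .get (ρ p) (t.subst ρ σ) (u.subst ρ σ)
  | _, .choice i j h t u, _, ρ, σ => .choice i j h (t.subst ρ σ) (u.subst ρ σ)

/-- The context of `k` variables, each of arity `m`. -/
abbrev vars (k m : ℕ) : Fin k → ℕ := fun _ => m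

open Term in
/-- The basic equations: rational convexity, commutativity, discardability and conjugacy.
Each is an equation between two terms in an explicit context. -/
inductive BaseEq : {k : ℕ} → {Δ : Fin k → ℕ} → {n : ℕ} → Term Δ n → Term Δ n → Prop
  /-- `(w ᵢ?ⱼ x) ᵢ₊ⱼ?ₖ₊ₗ (y ₖ?ₗ z) = (w ᵢ?ₖ y) ᵢ₊ₖ?ⱼ₊ₗ (x ⱼ?ₗ z)` -/
  | conv_exchange (i j k l : ℕ) (hij : 0 < i + j) (hkl : 0 < k + l) (hik : 0 < i + k)
      (hjl : 0 < j + l) (h : 0 < (i + j) + (k + l)) (h' : 0 < (i + k) + (j + l)) :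
      BaseEq (Δ := vars 4 0) (n := 0)
        (choice (i + j) (k + l) h
          (choice i j hij (var 0 ![]) (var 1 ![])) (choice k l hkl (var 2 ![]) (var 3 ![])))
        (choice (i + k) (j + l) h'
          (choice i k hik (var 0 ![]) (var 2 ![])) (choice j l hjl (var 1 ![]) (var 3 ![])))
  /-- `x ᵢ?ⱼ y = y ⱼ?ᵢ x` -/
  | conv_symm (i j : ℕ) (hij : 0 < i + j) (hji : 0 < j + i) :
      BaseEq (Δ := vars 2 0) (n := 0)
        (choice i j hij (var 0 ![]) (var 1 ![])) (choice j i hji (var 1 ![]) (var 0 ![]))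
  /-- `x ᵢ?₀ y = x` -/
  | conv_zero (i : ℕ) (hi : 0 < i + 0) :
      BaseEq (Δ := vars 2 0) (n := 0) (choice i 0 hi (var 0 ![]) (var 1 ![])) (var 0 ![])
  /-- `x ᵢ?ⱼ x = x` -/
  | conv_idem (i j : ℕ) (hij : 0 < i + j) :
      BaseEq (Δ := vars 1 0) (n := 0) (choice i j hij (var 0 ![]) (var 0 ![])) (var 0 ![])
  /-- `(w ?_q x) ?_p (y ?_q z) = (w ?_p y) ?_q (x ?_p z)`, with `p` the parameter `0` and
  `q` the parameter `1` -/
  | comm_get_get :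
      BaseEq (Δ := vars 4 0) (n := 2)
        (get 0 (get 1 (var 0 ![]) (var 1 ![])) (get 1 (var 2 ![]) (var 3 ![])))
        (get 1 (get 0 (var 0 ![]) (var 2 ![])) (get 0 (var 1 ![]) (var 3 ![])))
  /-- `ν_{i,j} p. ν_{k,l} q. x(p, q) = ν_{k,l} q. ν_{i,j} p. x(p, q)` -/
  | comm_nu_nu (i j k l : ℕ) (hi : 0 < i) (hj : 0 < j) (hk : 0 < k) (hl : 0 < l) :
      BaseEq (Δ := vars 1 2) (n := 0)
        (nu i j hi hj (nu k l hk hl (var 0 ![1, 0])))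
        (nu k l hk hl (nu i j hi hj (var 0 ![0, 1])))
  /-- `ν_{i,j} p. (x(p) ?_q y(p)) = (ν_{i,j} p. x(p)) ?_q (ν_{i,j} p. y(p))` -/
  | comm_nu_get (i j : ℕ) (hi : 0 < i) (hj : 0 < j) :
      BaseEq (Δ := vars 2 1) (n := 1)
        (nu i j hi hj (get 1 (var 0 ![0]) (var 1 ![0])))
        (get 0 (nu i j hi hj (var 0 ![0])) (nu i j hi hj (var 1 ![0])))
  /-- `ν_{i,j} p. (x(p) ₖ?ₗ y(p)) = (ν_{i,j} p. x(p)) ₖ?ₗ (ν_{i,j} p. y(p))` -/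
  | comm_nu_choice (i j k l : ℕ) (hi : 0 < i) (hj : 0 < j) (hkl : 0 < k + l) :
      BaseEq (Δ := vars 2 1) (n := 0)
        (nu i j hi hj (choice k l hkl (var 0 ![0]) (var 1 ![0])))
        (choice k l hkl (nu i j hi hj (var 0 ![0])) (nu i j hi hj (var 1 ![0])))
  /-- `(w ᵢ?ⱼ x) ?_p (y ᵢ?ⱼ z) = (w ?_p y) ᵢ?ⱼ (x ?_p z)` -/
  | comm_get_choice (i j : ℕ) (hij : 0 < i + j) :
      BaseEq (Δ := vars 4 0) (n := 1)
        (get 0 (choice i j hij (var 0 ![]) (var 1 ![])) (choice i j hij (var 2 ![]) (var 3 ![])))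
        (choice i j hij (get 0 (var 0 ![]) (var 2 ![])) (get 0 (var 1 ![]) (var 3 ![])))
  /-- `ν_{i,j} p. x = x` -/
  | discard_nu (i j : ℕ) (hi : 0 < i) (hj : 0 < j) :
      BaseEq (Δ := vars 1 0) (n := 0) (nu i j hi hj (var 0 ![])) (var 0 ![])
  /-- `x ?_p x = x` -/
  | discard_get :
      BaseEq (Δ := vars 1 0) (n := 1) (get 0 (var 0 ![]) (var 0 ![])) (var 0 ![])
  /-- `ν_{i,j} p. (x(p) ?_p y(p)) = (ν_{i+1,j} p. x(p)) ᵢ?ⱼ (ν_{i,j+1} p. y(p))` -/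
  | conjugacy (i j : ℕ) (hi : 0 < i) (hj : 0 < j) (hi' : 0 < i + 1) (hj' : 0 < j + 1)
      (hij : 0 < i + j) :
      BaseEq (Δ := vars 2 1) (n := 0)
        (nu i j hi hj (get 0 (var 0 ![0]) (var 1 ![0])))
        (choice i j hij (nu (i + 1) j hi' hj (var 0 ![0])) (nu i (j + 1) hi hj' (var 1 ![0])))

/-- Derivable equality `Γ ∣ Δ ⊢ t = u`: the closure of the basic equations under substitution,
congruence, reflexivity, symmetry and transitivity. -/
inductive Derivable :
    {k : ℕ} → {Δ : Fin k → ℕ} → {n : ℕ} → Term Δ n → Term Δ n → Prop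
  | base {k : ℕ} {Δ : Fin k → ℕ} {n : ℕ} {t u : Term Δ n} : BaseEq t u → Derivable t u
  | subst {k k' : ℕ} {Δ : Fin k → ℕ} {Δ' : Fin k' → ℕ} {n n' : ℕ} {t u : Term Δ n}
      (ρ : Fin n → Fin n') (σ : (x : Fin k) → Term Δ' (Δ x + n')) :
      Derivable t u → Derivable (t.subst ρ σ) (u.subst ρ σ)
  | refl {k : ℕ} {Δ : Fin k → ℕ} {n : ℕ} (t : Term Δ n) : Derivable t t
  | symm {k : ℕ} {Δ : Fin k → ℕ} {n : ℕ} {t u : Term Δ n} : Derivable t u → Derivable u t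
  | trans {k : ℕ} {Δ : Fin k → ℕ} {n : ℕ} {t u v : Term Δ n} :
      Derivable t u → Derivable u v → Derivable t v
  | nu {k : ℕ} {Δ : Fin k → ℕ} {n : ℕ} (i j : ℕ) (hi : 0 < i) (hj : 0 < j)
      {t t' : Term Δ (n + 1)} :
      Derivable t t' → Derivable (Term.nu i j hi hj t) (Term.nu i j hi hj t')
  | get {k : ℕ} {Δ : Fin k → ℕ} {n : ℕ} (p : Fin n) {t t' u u' : Term Δ n} :
      Derivable t t' → Derivable u u' → Derivable (Term.get p t u) (Term.get p t' u')
  | choice {k : ℕ} {Δ : Fin k → ℕ} {n : ℕ} (i j : ℕ) (h : 0 < i + j) {t t' u u' : Term Δ n} :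
      Derivable t t' → Derivable u u' →
      Derivable (Term.choice i j h t u) (Term.choice i j h t' u')

end BetaBernoulli

/-! Interpret a term, at parameter values in `[0, 1]`, by the expected values `Term.eval` of
continuous test functions: `ν_{i,j}` integrates against a Beta density, `?_p` is a coin of bias `θ
p`, rational choice is a weighted average. The axioms are sound for this (`Derivable.eval_eq`). The
hypothesis then says that the expectations of `t` and `u`, as functions of the value of `q`, have
equal integrals against every Beta density. The densities with indices `(a + 1, 1)` already give all
moments, so by Weierstrass approximation these continuous functions agree on `[0, 1]`
(`Term.eval_eq_of_nu`). What remains is completeness of the interpretation (`Cls.eq_of_eval_eq`).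

Completeness rests on normal forms (`Cls.exists_eq_tree`). Fix a list `l` of draws and a number `r`,
both large. Conjugacy allows extra draws under each binder until its indices satisfy `i + j = r +
1`, and exchangeability (`Cls.get_tree`) collects the draws from free parameters at the front. The
term becomes a tree of the draws in `l`, whose leaves depend only on the numbers of successes and
are uniform mixtures of chains, that is, of variables under binders with `i + j = r + 1`. Two terms
can share `l` and `r`, so only leaves have to be compared.

Two facts separate the leaves. Beta densities with fixed `i + j` are linearly independent and so
have dual functions; multiplied by indicators of the pattern of equal arguments, these single out
one chain when the parameter values are distinct (`Cls.exists_test`), the indicators being bounded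
limits of continuous functions. Hence the frequency of a chain at the leaves has the same
expectation over the draws for both terms. Up to a positive factor this expectation is a polynomial
in the odds `θ / (1 - θ)` whose coefficients are positive multiples of the leaf values, so the
frequencies agree (`eq_of_drawMean_eq`), and equal frequencies give equal mixtures
(`Cls.IsMix.eq_of_smul_eq`). -/

namespace BetaBernoulli

/-! ### Terms modulo derivable equality, and the axioms as identities between classes -/

variable {k : ℕ} {Δ : Fin k → ℕ} {n : ℕ}

theorem liftRen_comp {n n' n'' : ℕ} (ρ : Fin n → Fin n') (ρ' : Fin n' → Fin n'') :
    liftRen (ρ' ∘ ρ) = liftRen ρ' ∘ liftRen ρ := by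
  funext p
  refine Fin.cases ?_ (fun p => ?_) p <;> simp [liftRen]

theorem liftRen_id : liftRen (id : Fin n → Fin n) = id := by
  funext p
  refine Fin.cases ?_ (fun p => ?_) p <;> simp [liftRen]

namespace Term

theorem rename_rename (t : Term Δ n) {n' n'' : ℕ} (ρ : Fin n → Fin n') (ρ' : Fin n' → Fin n'') :
    (t.rename ρ).rename ρ' = t.rename (ρ' ∘ ρ) := by
  induction t generalizing n' n'' with
  | var x ps => rfl
  | nu i j hi hj t ih => simp [rename, ih, liftRen_comp]
  | get p t u iht ihu => simp [rename, iht, ihu]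
  | choice i j h t u iht ihu => simp [rename, iht, ihu]

theorem rename_id (t : Term Δ n) : t.rename id = t := by
  induction t with
  | var x ps => rfl
  | nu i j hi hj t ih => simp [rename, ih, liftRen_id]
  | get p t u iht ihu => simp [rename, iht, ihu]
  | choice i j h t u iht ihu => simp [rename, iht, ihu]

/-- Renaming along a map that is pointwise the identity. -/
theorem rename_eq_self (t : Term Δ n) (ρ : Fin n → Fin n) (h : ∀ p, ρ p = p) : t.rename ρ = t := by
  rw [show ρ = id from funext h, rename_id]

end Term

/-- Derivable equality as a setoid. -/
instance derivableSetoid (Δ : Fin k → ℕ) (n : ℕ) : Setoid (Term Δ n) where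
  r := Derivable
  iseqv := ⟨.refl, .symm, .trans⟩

/-- Terms up to derivable equality. -/
abbrev Cls (Δ : Fin k → ℕ) (n : ℕ) : Type := Quotient (derivableSetoid Δ n)

namespace Cls

/-- The class of a term. -/
abbrev mk (t : Term Δ n) : Cls Δ n := Quotient.mk _ t

theorem mk_eq {t u : Term Δ n} : mk t = mk u ↔ Derivable t u := Quotient.eq

/-- Variables. -/
def var (x : Fin k) (ps : Fin (Δ x) → Fin n) : Cls Δ n := mk (.var x ps)

/-- The binder `ν`. -/
def nu (i j : ℕ) (hi : 0 < i) (hj : 0 < j) : Cls Δ (n + 1) → Cls Δ n :=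
  Quotient.map (Term.nu i j hi hj) fun _ _ h => .nu i j hi hj h

/-- The choice `?_p`. -/
def get (p : Fin n) : Cls Δ n → Cls Δ n → Cls Δ n :=
  Quotient.map₂ (Term.get p) fun _ _ h _ _ h' => .get p h h'

/-- Rational choice, with `a` as the value of the meaningless `a ₀?₀ b`. -/
def ch (i j : ℕ) (a b : Cls Δ n) : Cls Δ n :=
  if h : 0 < i + j then
    Quotient.map₂ (Term.choice i j h) (fun _ _ h₁ _ _ h₂ => .choice i j h h₁ h₂) a b
  else a

theorem ch_mk {i j : ℕ} (h : 0 < i + j) (t u : Term Δ n) :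
    ch i j (mk t) (mk u) = mk (.choice i j h t u) := by
  simp only [ch, dif_pos h]; rfl

/-- Regarding a term as the value of a variable without formal parameters. -/
def plain (t : Term Δ n) : Term Δ (0 + n) := t.rename (Fin.natAdd 0)

/-- Regarding a term as the value of a variable with one formal parameter. -/
def unary (t : Term Δ (n + 1)) : Term Δ (1 + n) :=
  t.rename (Fin.cons (Fin.castAdd n 0) (Fin.natAdd 1))

/-- Regarding a term as the value of a variable with two formal parameters. -/
def binary (t : Term Δ (n + 2)) : Term Δ (2 + n) :=
  t.rename (Fin.cons (Fin.castAdd n 1) (Fin.cons (Fin.castAdd n 0) (Fin.natAdd 2)))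

theorem rename_plain (t : Term Δ n) (f : Fin 0 → Fin n) :
    (plain t).rename (Fin.append f id) = t := by
  rw [plain, Term.rename_rename]
  exact Term.rename_eq_self _ _ fun p => Fin.append_right f id p

theorem rename_lift_plain (t : Term Δ n) (f : Fin 0 → Fin (n + 1)) :
    ((plain t).rename (Fin.append (Fin.castAdd (n + 1)) fun p => Fin.natAdd 0 p.succ)).rename
      (Fin.append f id) = t.rename Fin.succ := by
  rw [plain, Term.rename_rename, Term.rename_rename]
  congr 1
  funext p
  rw [Function.comp_apply, Function.comp_apply, Fin.append_right, Fin.append_right]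
  rfl

theorem rename_unary (t : Term Δ (n + 1)) (f : Fin 1 → Fin (n + 1)) (hf : f 0 = 0) :
    ((unary t).rename (Fin.append (Fin.castAdd (n + 1)) fun p => Fin.natAdd 1 p.succ)).rename
      (Fin.append f id) = t := by
  rw [unary, Term.rename_rename, Term.rename_rename]
  refine Term.rename_eq_self _ _ fun p => ?_
  refine Fin.cases ?_ (fun p => ?_) p <;> simp [hf]

theorem get_get (p q : Fin n) (a b c d : Cls Δ n) :
    get p (get q a b) (get q c d) = get q (get p a c) (get p b d) := by
  induction a, b using Quotient.inductionOn₂ with | _ a b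
  induction c, d using Quotient.inductionOn₂ with | _ c d
  refine mk_eq.2 ?_
  have h := Derivable.subst (Δ' := Δ) (n' := n) ![p, q] ![plain a, plain b, plain c, plain d]
    (.base .comm_get_get)
  simpa [Term.subst, rename_plain] using h

theorem get_self (p : Fin n) (a : Cls Δ n) : get p a a = a := by
  induction a using Quotient.inductionOn with | _ a
  refine mk_eq.2 ?_
  have h := Derivable.subst (Δ' := Δ) (n' := n) ![p] ![plain a] (.base .discard_get)
  simpa [Term.subst, rename_plain] using h

theorem get_ch (p : Fin n) (i j : ℕ) (a b c d : Cls Δ n) :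
    get p (ch i j a b) (ch i j c d) = ch i j (get p a c) (get p b d) := by
  induction a, b using Quotient.inductionOn₂ with | _ a b
  induction c, d using Quotient.inductionOn₂ with | _ c d
  by_cases hij : 0 < i + j
  · simp only [ch_mk hij]
    refine Eq.trans ?_ (ch_mk hij _ _).symm
    refine mk_eq.2 ?_
    have h := Derivable.subst (Δ' := Δ) (n' := n) ![p] ![plain a, plain b, plain c, plain d]
      (.base (.comm_get_choice i j hij))
    simpa [Term.subst, rename_plain] using h
  · simp [ch, hij]

theorem ch_exchange (i j k l : ℕ) (hij : 0 < i + j) (hkl : 0 < k + l) (hik : 0 < i + k)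
    (hjl : 0 < j + l) (a b c d : Cls Δ n) :
    ch (i + j) (k + l) (ch i j a b) (ch k l c d) = ch (i + k) (j + l) (ch i k a c) (ch j l b d) := by
  induction a, b using Quotient.inductionOn₂ with | _ a b
  induction c, d using Quotient.inductionOn₂ with | _ c d
  have h₁ : 0 < (i + j) + (k + l) := by omega
  have h₂ : 0 < (i + k) + (j + l) := by omega
  simp only [ch_mk hij, ch_mk hkl, ch_mk hik, ch_mk hjl, ch_mk h₁, ch_mk h₂]
  refine mk_eq.2 ?_
  have h := Derivable.subst (Δ' := Δ) (n' := n) ![] ![plain a, plain b, plain c, plain d]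
    (.base (.conv_exchange i j k l hij hkl hik hjl h₁ h₂))
  simpa [Term.subst, rename_plain] using h

theorem ch_symm (i j : ℕ) (h : 0 < i + j) (a b : Cls Δ n) : ch i j a b = ch j i b a := by
  induction a, b using Quotient.inductionOn₂ with | _ a b
  have h' : 0 < j + i := by omega
  simp only [ch_mk h, ch_mk h']
  refine mk_eq.2 ?_
  have h := Derivable.subst (Δ' := Δ) (n' := n) ![] ![plain a, plain b]
    (.base (.conv_symm i j h h'))
  simpa [Term.subst, rename_plain] using h

theorem ch_zero (i : ℕ) (a b : Cls Δ n) : ch i 0 a b = a := by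
  induction a, b using Quotient.inductionOn₂ with | _ a b
  by_cases h : 0 < i + 0
  · simp only [ch_mk h]
    refine mk_eq.2 ?_
    have h := Derivable.subst (Δ' := Δ) (n' := n) ![] ![plain a, plain b] (.base (.conv_zero i h))
    simpa [Term.subst, rename_plain] using h
  · exact dif_neg h

theorem ch_self (i j : ℕ) (a : Cls Δ n) : ch i j a a = a := by
  induction a using Quotient.inductionOn with | _ a
  by_cases h : 0 < i + j
  · simp only [ch_mk h]
    refine mk_eq.2 ?_
    have h := Derivable.subst (Δ' := Δ) (n' := n) ![] ![plain a] (.base (.conv_idem i j h))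
    simpa [Term.subst, rename_plain] using h
  · simp [ch, h]

theorem nu_get (i j : ℕ) (hi : 0 < i) (hj : 0 < j) (p : Fin n) (a b : Cls Δ (n + 1)) :
    nu i j hi hj (get p.succ a b) = get p (nu i j hi hj a) (nu i j hi hj b) := by
  induction a, b using Quotient.inductionOn₂ with | _ a b
  refine mk_eq.2 ?_
  have h := Derivable.subst (Δ' := Δ) (n' := n) ![p] ![unary a, unary b]
    (.base (.comm_nu_get i j hi hj))
  simpa [Term.subst, rename_unary, liftRen] using h

theorem nu_ch (i j k l : ℕ) (hi : 0 < i) (hj : 0 < j) (a b : Cls Δ (n + 1)) :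
    nu i j hi hj (ch k l a b) = ch k l (nu i j hi hj a) (nu i j hi hj b) := by
  induction a, b using Quotient.inductionOn₂ with | _ a b
  by_cases hkl : 0 < k + l
  · simp only [ch_mk hkl]
    refine Eq.trans ?_ (ch_mk hkl _ _).symm
    refine mk_eq.2 ?_
    have h := Derivable.subst (Δ' := Δ) (n' := n) ![] ![unary a, unary b]
      (.base (.comm_nu_choice i j k l hi hj hkl))
    simpa [Term.subst, rename_unary, liftRen] using h
  · simp [ch, hkl]

theorem nu_conj (i j : ℕ) (hi : 0 < i) (hj : 0 < j) (a b : Cls Δ (n + 1)) :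
    nu i j hi hj (get 0 a b) =
      ch i j (nu (i + 1) j (i.succ_pos) hj a) (nu i (j + 1) hi j.succ_pos b) := by
  induction a, b using Quotient.inductionOn₂ with | _ a b
  have hij : 0 < i + j := by omega
  refine Eq.trans ?_ (ch_mk hij _ _).symm
  refine mk_eq.2 ?_
  have h := Derivable.subst (Δ' := Δ) (n' := n) ![] ![unary a, unary b]
    (.base (.conjugacy i j hi hj i.succ_pos j.succ_pos hij))
  simpa [Term.subst, rename_unary, liftRen] using h

theorem nu_weaken (i j : ℕ) (hi : 0 < i) (hj : 0 < j) (t : Term Δ n) :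
    nu i j hi hj (mk (t.rename Fin.succ)) = mk t := by
  refine mk_eq.2 ?_
  have h := Derivable.subst (Δ' := Δ) (n' := n) ![] ![plain t] (.base (.discard_nu i j hi hj))
  simpa [-Fin.natAdd_zero, Term.subst, rename_plain, rename_lift_plain] using h

theorem nu_nu (i j k l : ℕ) (hi : 0 < i) (hj : 0 < j) (hk : 0 < k) (hl : 0 < l)
    (t : Term Δ (n + 2)) :
    nu i j hi hj (nu k l hk hl (mk t)) =
      nu k l hk hl (nu i j hi hj (mk (t.rename (Equiv.swap 0 1)))) := by
  refine mk_eq.2 ?_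
  have h := Derivable.subst (Δ' := Δ) (n' := n) ![] ![binary t]
    (.base (.comm_nu_nu i j k l hi hj hk hl))
  have e (f : Fin 2 → Fin (n + 2)) (g : Fin (n + 2) → Fin (n + 2)) (h0 : g 0 = f 1)
      (h1 : g 1 = f 0) (h2 : ∀ p : Fin n, g p.succ.succ = p.succ.succ) :
      (((binary t).rename
        (Fin.append (Fin.castAdd (n + 1)) fun p => Fin.natAdd 2 p.succ)).rename
        (Fin.append (Fin.castAdd (n + 2)) fun p => Fin.natAdd 2 p.succ)).rename
      (Fin.append f id) = t.rename g := by
    rw [binary, Term.rename_rename, Term.rename_rename, Term.rename_rename]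
    congr 1
    funext p
    refine Fin.cases ?_ (fun p => Fin.cases ?_ (fun p => ?_) p) p
    · simp [h0]
    · simp [h1]
    · simp [h2]
  simp only [Term.subst, Matrix.cons_val_fin_one] at h
  -- The inner binder has index `0` but is the second argument on the left of the axiom. `binary`
  -- undoes this reversal, so the left side is not renamed and the right side is renamed by the
  -- swap.
  rw [e _ id, e _ (Equiv.swap 0 1), Term.rename_id] at h
  · exact h
  all_goals simp [liftRen, Equiv.swap_apply_def, Fin.ext_iff]

end Cls
end BetaBernoulli

/-! ### Uniform mixtures, trees of draws and normal forms -/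

namespace BetaBernoulli

variable {k : ℕ} {Δ : Fin k → ℕ} {n : ℕ}

namespace Cls

theorem ch_zero_left (j : ℕ) (hj : 0 < j) (a b : Cls Δ n) : ch 0 j a b = b := by
  rw [ch_symm 0 j (by omega), ch_zero]

/-- Only the ratio of the weights matters: the exchange law merges `ch i j a b` with a copy of
weights `c * i`, `c * j`, and idempotence collapses both sides. -/
theorem ch_mul (c i j : ℕ) (hc : 0 < c) (a b : Cls Δ n) :
    ch (c * i) (c * j) a b = ch i j a b := by
  rcases Nat.eq_zero_or_pos j with rfl | hj
  · simp [ch_zero]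
  rcases Nat.eq_zero_or_pos i with rfl | hi
  · rw [mul_zero, ch_zero_left _ (Nat.mul_pos hc hj), ch_zero_left _ hj]
  induction c, hc using Nat.le_induction with
  | base => simp
  | succ c hc ih =>
    have h := ch_exchange i j (c * i) (c * j) (by omega) (by positivity) (by omega) (by omega)
      a b a b
    rw [ih, ch_self, ch_self, ch_self] at h
    rw [h, add_mul, add_mul, one_mul, one_mul, add_comm i, add_comm j]

theorem ch_one_left (m l : ℕ) (a b : Cls Δ n) :
    ch 1 (m + l) a (ch m l a b) = ch (m + 1) l a b := by
  rcases Nat.eq_zero_or_pos l with rfl | hl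
  · simp [ch_zero, ch_self]
  rcases Nat.eq_zero_or_pos m with rfl | hm
  · rw [ch_zero_left l hl, zero_add, zero_add]
  have h := ch_exchange 1 0 m l (by omega) (by omega) (by omega) (by omega) a b a b
  rw [ch_zero, ch_self, ch_self] at h
  rw [show m + 1 = 1 + m by omega, show 1 = 1 + 0 from rfl, h, zero_add]

theorem ch_one_right (m l : ℕ) (h : 0 < m + l) (a b : Cls Δ n) :
    ch 1 (m + l) b (ch m l a b) = ch m (l + 1) a b := by
  rw [ch_symm m l h, add_comm m l, ch_one_left, ch_symm (l + 1) m (by omega)]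

/-- `IsMix s a` says that `a` is the uniform mixture of the nonempty multiset `s`. -/
inductive IsMix : Multiset (Cls Δ n) → Cls Δ n → Prop
  | single (a : Cls Δ n) : IsMix {a} a
  | add {s t : Multiset (Cls Δ n)} {a b : Cls Δ n} : IsMix s a → IsMix t b →
      IsMix (s + t) (ch s.card t.card a b)

theorem IsMix.card_pos {s : Multiset (Cls Δ n)} {a : Cls Δ n} (h : IsMix s a) : 0 < s.card := by
  induction h with
  | single a => simp
  | add _ _ hs ht => rw [Multiset.card_add]; omega

theorem IsMix.smul {s : Multiset (Cls Δ n)} {a : Cls Δ n} (h : IsMix s a) {c : ℕ} (hc : 0 < c) :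
    IsMix (c • s) a := by
  induction c, hc using Nat.le_induction with
  | base => simpa using h
  | succ c hc ih =>
    rw [succ_nsmul]
    simpa [ch_self] using ih.add h

/-- The multiplicities bring the two cardinalities into the ratio `i : j`. -/
theorem IsMix.ch {s t : Multiset (Cls Δ n)} {a b : Cls Δ n} (hs : IsMix s a) (ht : IsMix t b)
    {i j : ℕ} (hi : 0 < i) (hj : 0 < j) :
    IsMix ((i * t.card) • s + (j * s.card) • t) (ch i j a b) := by
  have h := (hs.smul (Nat.mul_pos hi ht.card_pos)).add (ht.smul (Nat.mul_pos hj hs.card_pos))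
  rw [Multiset.card_nsmul, Multiset.card_nsmul,
    show i * t.card * s.card = s.card * t.card * i by ring,
    show j * s.card * t.card = s.card * t.card * j by ring,
    ch_mul _ _ _ (Nat.mul_pos hs.card_pos ht.card_pos)] at h
  exact h

theorem IsMix.nu {s : Multiset (Cls Δ (n + 1))} {a : Cls Δ (n + 1)} (h : IsMix s a) (i j : ℕ)
    (hi : 0 < i) (hj : 0 < j) : IsMix (s.map (nu i j hi hj)) (nu i j hi hj a) := by
  induction h with
  | single a => simpa using IsMix.single _
  | add _ _ hs ht =>
    rw [Multiset.map_add, nu_ch]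
    simpa using hs.add ht

/-- One step in the computation of a uniform mixture together with the number of its terms. -/
def mixStep (a : Cls Δ n) (v : ℕ × Cls Δ n) : ℕ × Cls Δ n := (v.1 + 1, ch 1 v.1 a v.2)

/-- This makes the fold well defined on multisets. For `m > 0` both orders are the mixture of `ch 1
1 a b` and `v` with weights `2 : m`; for `m = 0` the starting value has weight zero and drops out.
-/
instance : LeftCommutative (mixStep (Δ := Δ) (n := n)) where
  left_comm a b v := by
    obtain ⟨m, v⟩ := v
    have key (a b : Cls Δ n) (hm : 0 < m) :
        ch 1 (m + 1) a (ch 1 m b v) = ch 2 m (ch 1 1 a b) v := by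
      have h := ch_exchange 1 0 1 m (by omega) (by omega) (by omega) (by omega) a v b v
      rw [ch_zero, ch_self] at h
      rw [show ch 1 (m + 1) a (ch 1 m b v) = ch (1 + 0) (1 + m) a (ch 1 m b v) by
        rw [add_comm m 1], h, zero_add]
    refine Prod.ext rfl ?_
    simp only [mixStep]
    rcases Nat.eq_zero_or_pos m with rfl | hm
    · rw [ch_zero, ch_zero, ch_symm _ _ (by omega)]
    · rw [key a b hm, key b a hm, ch_symm 1 1 (by omega)]

/-- The uniform mixture of a multiset, with value `d` at the empty multiset. -/
def mix (d : Cls Δ n) (s : Multiset (Cls Δ n)) : Cls Δ n := (s.foldr mixStep (0, d)).2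

theorem foldr_mixStep_fst (d : Cls Δ n) (s : Multiset (Cls Δ n)) :
    (s.foldr mixStep (0, d)).1 = s.card := by
  induction s using Multiset.induction_on with
  | empty => simp
  | cons a s ih => simp [mixStep, ih]

theorem mix_cons (d a : Cls Δ n) (s : Multiset (Cls Δ n)) :
    mix d (a ::ₘ s) = ch 1 s.card a (mix d s) := by
  simp [mix, mixStep, foldr_mixStep_fst]

theorem mix_add (d : Cls Δ n) (s t : Multiset (Cls Δ n)) (ht : 0 < t.card) :
    mix d (s + t) = ch s.card t.card (mix d s) (mix d t) := by
  induction s using Multiset.induction_on with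
  | empty => rw [zero_add, Multiset.card_zero, ch_zero_left _ ht]
  | cons a s ih =>
    have h := ch_exchange 1 s.card 0 t.card (by omega) (by omega) (by omega) (by omega)
      a (mix d s) a (mix d t)
    rw [ch_zero, ch_zero_left _ ht] at h
    rw [Multiset.cons_add, mix_cons, ih, Multiset.card_cons, Multiset.card_add, mix_cons,
      add_comm s.card 1, show (1 : ℕ) = 1 + 0 from rfl, ← h, zero_add]

/-- Comparison with the canonical fold shows that the multiset alone determines the mixture, however
it was bracketed. -/
theorem IsMix.mix_eq {s : Multiset (Cls Δ n)} {a : Cls Δ n} (h : IsMix s a) (d : Cls Δ n) :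
    mix d s = a := by
  induction h with
  | single a => simp [mix, mixStep, ch_zero]
  | add hs ht ihs iht => rw [mix_add _ _ _ ht.card_pos, ihs, iht]

theorem IsMix.eq_of_smul_eq {s t : Multiset (Cls Δ n)} {a b : Cls Δ n} (hs : IsMix s a)
    (ht : IsMix t b) (h : t.card • s = s.card • t) : a = b := by
  rw [← (hs.smul ht.card_pos).mix_eq a, h, (ht.smul hs.card_pos).mix_eq a]

/-- A variable below binders `ν_{i,j}` with `i + j = r + 1`. -/
inductive IsChain (r : ℕ) : {n : ℕ} → Cls Δ n → Prop
  | var {n : ℕ} (x : Fin k) (ps : Fin (Δ x) → Fin n) : IsChain r (var x ps)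
  | nu {n : ℕ} (i j : ℕ) (hi : 0 < i) (hj : 0 < j) (h : i + j = r + 1) {a : Cls Δ (n + 1)} :
      IsChain r a → IsChain r (nu i j hi hj a)

/-- A uniform mixture of chains. -/
def ChainMix (r : ℕ) (a : Cls Δ n) : Prop := ∃ s, IsMix s a ∧ ∀ c ∈ s, IsChain r c

theorem ChainMix.ch {r : ℕ} {a b : Cls Δ n} (ha : ChainMix r a) (hb : ChainMix r b) (i j : ℕ) :
    ChainMix r (ch i j a b) := by
  rcases Nat.eq_zero_or_pos j with rfl | hj
  · rwa [ch_zero]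
  rcases Nat.eq_zero_or_pos i with rfl | hi
  · rwa [ch_zero_left _ hj]
  obtain ⟨s, hs, hs'⟩ := ha
  obtain ⟨t, ht, ht'⟩ := hb
  refine ⟨_, hs.ch ht hi hj, fun c hc => ?_⟩
  rcases Multiset.mem_add.1 hc with h | h
  · exact hs' c (Multiset.mem_of_mem_nsmul h)
  · exact ht' c (Multiset.mem_of_mem_nsmul h)

theorem ChainMix.nu {r : ℕ} {a : Cls Δ (n + 1)} (ha : ChainMix r a) (i j : ℕ) (hi : 0 < i)
    (hj : 0 < j) (h : i + j = r + 1) : ChainMix r (nu i j hi hj a) := by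
  obtain ⟨s, hs, hs'⟩ := ha
  refine ⟨_, hs.nu i j hi hj, fun c hc => ?_⟩
  obtain ⟨b, hb, rfl⟩ := Multiset.mem_map.1 hc
  exact .nu i j hi hj h (hs' b hb)

open Finsupp (single)

/-- The tree that draws from the parameters of a list in turn, and whose leaves depend only on how
often each parameter has come out true. -/
noncomputable def tree : List (Fin n) → ((Fin n →₀ ℕ) → Cls Δ n) → Cls Δ n
  | [], L => L 0
  | p :: l, L => get p (tree l fun k => L (k + single p 1)) (tree l L)

/-- No path through the tree sees `p` come out true more than `l.count p` times. -/
theorem tree_congr {l : List (Fin n)} {L L' : (Fin n →₀ ℕ) → Cls Δ n}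
    (h : ∀ k : Fin n →₀ ℕ, (∀ p, k p ≤ l.count p) → L k = L' k) : tree l L = tree l L' := by
  induction l generalizing L L' with
  | nil => exact h 0 (by simp)
  | cons p l ih =>
    rw [tree, tree, ih fun k hk => h _ fun q => ?_, ih fun k hk => h _ fun q => ?_]
    · exact (hk q).trans (List.count_le_count_cons)
    · rw [Finsupp.add_apply, List.count_cons, Finsupp.single_apply]
      simpa using hk q

theorem tree_const (l : List (Fin n)) (a : Cls Δ n) : tree l (fun _ => a) = a := by
  induction l with
  | nil => rfl
  | cons p l ih => rw [tree, ih, get_self]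

theorem tree_ch (l : List (Fin n)) (i j : ℕ) (L L' : (Fin n →₀ ℕ) → Cls Δ n) :
    ch i j (tree l L) (tree l L') = tree l fun k => ch i j (L k) (L' k) := by
  induction l generalizing L L' with
  | nil => rfl
  | cons p l ih => rw [tree, tree, tree, ← get_ch, ih, ih]

theorem tree_perm {l l' : List (Fin n)} (h : l.Perm l') (L : (Fin n →₀ ℕ) → Cls Δ n) :
    tree l L = tree l' L := by
  induction h generalizing L with
  | nil => rfl
  | cons p _ ih => rw [tree, tree, ih, ih]
  | swap p q l =>
    simp only [tree]
    rw [get_get]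
    simp only [add_right_comm]
  | trans _ _ ih₁ ih₂ => rw [ih₁, ih₂]

theorem tree_append (l l' : List (Fin n)) (L : (Fin n →₀ ℕ) → Cls Δ n) :
    tree (l ++ l') L = tree l fun k => tree l' fun k' => L (k + k') := by
  induction l generalizing L with
  | nil => simp [tree]
  | cons p l ih => simp only [List.cons_append, tree, ih, add_right_comm]

theorem nu_tree (l : List (Fin n)) (i j : ℕ) (hi : 0 < i) (hj : 0 < j)
    (L : (Fin (n + 1) →₀ ℕ) → Cls Δ (n + 1)) :
    nu i j hi hj (tree (l.map Fin.succ) L) =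
      tree l fun k => nu i j hi hj (L (k.mapDomain Fin.succ)) := by
  induction l generalizing L with
  | nil => simp [tree]
  | cons p l ih =>
    simp only [List.map_cons, tree, nu_get, ih, Finsupp.mapDomain_add, Finsupp.mapDomain_single]

/-- Exchangeability: given `k p` successes among the `l.count p + 1` draws from `p`, the selecting
draw is one of the successes with probability `k p / (l.count p + 1)`. The truncated `k - single p
1` is harmless, since it has weight zero when `k p = 0`. -/
theorem get_tree (p : Fin n) (l : List (Fin n)) (L L' : (Fin n →₀ ℕ) → Cls Δ n) :
    get p (tree l L) (tree l L') = tree (p :: l) fun k =>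
      ch (k p) (l.count p + 1 - k p) (L (k - single p 1)) (L' k) := by
  induction l generalizing L L' with
  | nil => simp [tree, ch_zero, ch_zero_left]
  | cons q l ih =>
    by_cases hqp : q = p
    · subst hqp
      have e : get q (tree (q :: l) L) (tree (q :: l) L') = _ :=
        (get_get q q _ _ _ _).trans (congrArg₂ (get q) (ih _ _) (ih L L'))
      -- There are now `l.count q + 2` draws from `q`. Average two forms of the class with weights
      -- `1 : l.count q + 1`: the given one, selected by the outermost draw, and the form `e`, where
      -- the selecting draw has been moved inward and averaged by induction.
      rw [← ch_self 1 (l.count q + 1) (get q (tree (q :: l) L) (tree (q :: l) L'))]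
      nth_rw 2 [e]
      rw [← get_ch, tree_ch, tree_ch]
      refine (congrArg₂ (get q) (tree_congr fun k hk => ?_) (tree_congr fun k hk => ?_)).trans rfl
      all_goals
        have hk' := hk q
        rw [List.count_cons_self] at hk'
        obtain ⟨m, hm⟩ := Nat.exists_eq_add_of_le hk'
      · simp only [Finsupp.add_apply, Finsupp.single_eq_same, List.count_cons_self,
          add_tsub_cancel_right]
        have e' : ch (k q) m (L (k - single q 1 + single q 1)) (L' (k + single q 1)) =
            ch (k q) m (L k) (L' (k + single q 1)) := by
          rcases Nat.eq_zero_or_pos (k q) with h0 | h0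
          · rw [h0, ch_zero_left _ (by omega), ch_zero_left _ (by omega)]
          · rw [tsub_add_cancel_of_le (Finsupp.single_le_iff.2 (Nat.succ_le_of_lt h0))]
        rw [hm, show k q + m + 1 - (k q + 1) = m by omega, add_tsub_cancel_left, e', ch_one_left]
      · simp only [List.count_cons_self]
        rw [hm, add_tsub_cancel_left, show k q + m + 1 - k q = m + 1 by omega,
          ch_one_right _ _ (by omega)]
    · rw [tree, tree, get_get, ih, ih, tree_perm (List.Perm.swap q p l)]
      have e (k : Fin n →₀ ℕ) (hk : single p 1 ≤ k) :
          k + single q 1 - single p 1 = k - single p 1 + single q 1 :=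
        tsub_add_eq_add_tsub hk ▸ rfl
      nth_rw 3 [tree]
      refine congrArg₂ (get q) (tree_congr fun k hk => ?_) (tree_congr fun k hk => ?_)
      · simp only [Finsupp.add_apply, Finsupp.single_eq_of_ne' hqp, add_zero,
          List.count_cons_of_ne hqp]
        rcases Nat.eq_zero_or_pos (k p) with h0 | h0
        · rw [h0, ch_zero_left _ (by omega), ch_zero_left _ (by omega)]
        · rw [e k (Finsupp.single_le_iff.2 (Nat.succ_le_of_lt h0))]
      · rw [List.count_cons_of_ne hqp]

/-- Each draw from the bound parameter is turned by conjugacy into a rational choice and raises `i +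
j` by one; after `d` draws the sum is `r + 1`. -/
theorem ChainMix.nu_tree_replicate {r d : ℕ} {L : (Fin (n + 1) →₀ ℕ) → Cls Δ (n + 1)}
    (hL : ∀ k, ChainMix r (L k)) (i j : ℕ) (hi : 0 < i) (hj : 0 < j) (h : i + j + d = r + 1) :
    ChainMix r (Cls.nu i j hi hj (tree (List.replicate d 0) L)) := by
  induction d generalizing L i j with
  | zero => exact (hL 0).nu i j hi hj h
  | succ d ih =>
    rw [List.replicate_succ, tree, nu_conj]
    exact (ih (fun k => hL _) _ _ _ _ (by omega)).ch (ih hL _ _ _ _ (by omega)) _ _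

/-- Normal forms: every term is a tree of draws from its parameters over mixtures of chains. -/
theorem exists_eq_tree (t : Cls Δ n) : ∃ N, ∀ l : List (Fin n), (∀ p, N ≤ l.count p) → ∀ r ≥ N,
    ∃ L : (Fin n →₀ ℕ) → Cls Δ n, (∀ k, ChainMix r (L k)) ∧ t = tree l L := by
  induction t using Quotient.inductionOn with | _ t
  induction t with
  | var x ps =>
    refine ⟨0, fun l _ r _ => ⟨fun _ => var x ps, fun _ => ?_, (tree_const l _).symm⟩⟩
    exact ⟨_, .single _, by simpa using .var x ps⟩
  | nu i j hi hj t ih =>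
    obtain ⟨N, hN⟩ := ih
    refine ⟨N + i + j, fun l hl r hr => ?_⟩
    -- The bound parameter gets exactly the number of draws that will raise `i + j` to `r + 1`; `r ≥
    -- N + i + j` makes this at least `N`.
    obtain ⟨L, hL, ht⟩ := hN (l.map Fin.succ ++ List.replicate (r + 1 - i - j) 0)
      (fun p => by
        rw [List.count_append, List.count_replicate]
        refine Fin.cases ?_ (fun p => ?_) p
        · simp only [beq_self_eq_true, if_true]
          omega
        · rw [List.count_map_of_injective _ _ (Fin.succ_injective _)]
          have := hl p
          omega) r (by omega)
    refine ⟨fun k => Cls.nu i j hi hj (tree (List.replicate (r + 1 - i - j) 0) fun k' =>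
      L (k.mapDomain Fin.succ + k')), fun k => ?_, (congrArg (Cls.nu i j hi hj) ht).trans ?_⟩
    · exact ChainMix.nu_tree_replicate (fun k' => hL _) i j hi hj (by omega)
    · rw [tree_append, nu_tree]
  | get p t u iht ihu =>
    obtain ⟨N, hN⟩ := iht
    obtain ⟨N', hN'⟩ := ihu
    refine ⟨N + N' + 1, fun l hl r hr => ?_⟩
    -- One draw from `p` is set aside for the outer `?_p`; the summand `1` in the bound pays for it.
    have hc (q : Fin _) : N + N' ≤ (l.erase p).count q := by
      have := hl q
      rw [List.count_erase]
      split_ifs <;> omega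
    obtain ⟨L, hL, ht⟩ := hN (l.erase p) (fun q => by have := hc q; omega) r (by omega)
    obtain ⟨L', hL', hu⟩ := hN' (l.erase p) (fun q => by have := hc q; omega) r (by omega)
    have hp : p ∈ l := List.count_pos_iff.1 (by have := hl p; omega)
    refine ⟨fun k => ch (k p) ((l.erase p).count p + 1 - k p) (L (k - single p 1)) (L' k),
      fun k => (hL _).ch (hL' _) _ _, (congrArg₂ (Cls.get p) ht hu).trans ?_⟩
    rw [get_tree, tree_perm (List.perm_cons_erase hp).symm]
  | choice i j h t u iht ihu =>
    obtain ⟨N, hN⟩ := iht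
    obtain ⟨N', hN'⟩ := ihu
    refine ⟨N + N', fun l hl r hr => ?_⟩
    obtain ⟨L, hL, ht⟩ := hN l (fun q => by have := hl q; omega) r (by omega)
    obtain ⟨L', hL', hu⟩ := hN' l (fun q => by have := hl q; omega) r (by omega)
    refine ⟨_, fun k => (hL k).ch (hL' k) i j, ?_⟩
    rw [← tree_ch, ← ht, ← hu]
    exact (ch_mk h t u).symm

end Cls
end BetaBernoulli

/-! ### Beta densities, expected values and soundness -/

namespace BetaBernoulli

variable {k : ℕ} {Δ : Fin k → ℕ} {n : ℕ}

open intervalIntegral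

/-- The Beta integral `∫₀¹ zᵃ (1 - z)ᵇ dz`. -/
noncomputable def betaInt (a b : ℕ) : ℝ := ∫ z in (0 : ℝ)..1, z ^ a * (1 - z) ^ b

/-- The density of the Beta distribution with parameters `i, j > 0`. -/
noncomputable def dens (i j : ℕ) (z : ℝ) : ℝ :=
  z ^ (i - 1) * (1 - z) ^ (j - 1) / betaInt (i - 1) (j - 1)

theorem betaInt_pos (a b : ℕ) : 0 < betaInt a b := by
  refine intervalIntegral_pos_of_pos_on ?_ (fun z hz => ?_) one_pos
  · exact (by fun_prop : Continuous fun z : ℝ => z ^ a * (1 - z) ^ b).intervalIntegrable _ _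
  · have := sub_pos.2 hz.2
    have := hz.1
    positivity

theorem betaInt_add (a b : ℕ) : betaInt (a + 1) b + betaInt a (b + 1) = betaInt a b := by
  rw [betaInt, betaInt, betaInt, ← integral_add]
  · congr 1
    funext z
    ring
  all_goals exact Continuous.intervalIntegrable (by fun_prop) _ _

/-- Integration by parts: `z ^ (a + 1) * (1 - z) ^ (b + 1)` vanishes at both ends. -/
theorem betaInt_mul (a b : ℕ) :
    (a + 1) * betaInt a (b + 1) = (b + 1) * betaInt (a + 1) b := by
  have h (z : ℝ) : HasDerivAt (fun z : ℝ => z ^ (a + 1) * (1 - z) ^ (b + 1))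
      ((a + 1) * (z ^ a * (1 - z) ^ (b + 1)) - (b + 1) * (z ^ (a + 1) * (1 - z) ^ b)) z := by
    have h₁ := (hasDerivAt_pow (a + 1) z).mul (((hasDerivAt_id z).const_sub 1).pow (b + 1))
    refine (h₁.congr_deriv ?_)
    simp
    ring
  have e := integral_eq_sub_of_hasDerivAt (a := 0) (b := 1) (fun z _ => h z)
    (Continuous.intervalIntegrable (by fun_prop) _ _)
  rw [integral_sub, integral_const_mul, integral_const_mul] at e
  · simp at e
    exact sub_eq_zero.1 e
  all_goals exact Continuous.intervalIntegrable (by fun_prop) _ _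

theorem betaInt_succ_left (a b : ℕ) :
    betaInt (a + 1) b = (a + 1) / (a + b + 2) * betaInt a b := by
  have h₁ := betaInt_add a b
  have h₂ := betaInt_mul a b
  field_simp
  linear_combination (a + 1 : ℝ) * h₁ - h₂

theorem betaInt_succ_right (a b : ℕ) :
    betaInt a (b + 1) = (b + 1) / (a + b + 2) * betaInt a b := by
  have h₁ := betaInt_add a b
  have h₂ := betaInt_mul a b
  field_simp
  linear_combination (b + 1 : ℝ) * h₁ + h₂

@[fun_prop]
theorem continuous_dens (i j : ℕ) : Continuous (dens i j) := by
  unfold dens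
  fun_prop

theorem dens_nonneg (i j : ℕ) {z : ℝ} (h₀ : 0 ≤ z) (h₁ : z ≤ 1) : 0 ≤ dens i j z := by
  have := sub_nonneg.2 h₁
  have := betaInt_pos (i - 1) (j - 1)
  unfold dens
  positivity

theorem integral_dens (i j : ℕ) : ∫ z in (0 : ℝ)..1, dens i j z = 1 := by
  simp only [dens]
  rw [integral_div]
  exact div_self (betaInt_pos _ _).ne'

/-- Bayesian update of a Beta prior by a success; with `dens_mul_one_sub` it yields soundness of
conjugacy. -/
theorem dens_mul_self {i j : ℕ} (hi : 0 < i) (hj : 0 < j) (z : ℝ) :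
    dens i j z * z = i / (i + j) * dens (i + 1) j z := by
  obtain ⟨a, rfl⟩ := Nat.exists_eq_succ_of_ne_zero hi.ne'
  obtain ⟨b, rfl⟩ := Nat.exists_eq_succ_of_ne_zero hj.ne'
  have := (betaInt_pos a b).ne'
  simp only [dens, Nat.succ_eq_add_one, Nat.add_sub_cancel, betaInt_succ_left]
  push_cast
  field_simp
  ring

theorem dens_mul_one_sub {i j : ℕ} (hi : 0 < i) (hj : 0 < j) (z : ℝ) :
    dens i j z * (1 - z) = j / (i + j) * dens i (j + 1) z := by
  obtain ⟨a, rfl⟩ := Nat.exists_eq_succ_of_ne_zero hi.ne'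
  obtain ⟨b, rfl⟩ := Nat.exists_eq_succ_of_ne_zero hj.ne'
  have := (betaInt_pos a b).ne'
  simp only [dens, Nat.succ_eq_add_one, Nat.add_sub_cancel, betaInt_succ_right]
  push_cast
  field_simp
  ring

/-- Test functions: a real function of the arguments of each variable. -/
abbrev Test (Δ : Fin k → ℕ) : Type := (x : Fin k) → (Fin (Δ x) → ℝ) → ℝ

/-- The expected value of a test function under the random variable with random arguments that a
term denotes, given the values of its parameters. -/
noncomputable def Term.eval : {n : ℕ} → Term Δ n → Test Δ → (Fin n → ℝ) → ℝ
  | _, .var x ps, g, θ => g x fun a => θ (ps a)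
  | _, .nu i j _ _ t, g, θ => ∫ z in (0 : ℝ)..1, dens i j z * t.eval g (Fin.cons z θ)
  | _, .get p t u, g, θ => θ p * t.eval g θ + (1 - θ p) * u.eval g θ
  | _, .choice i j _ t u, g, θ => (i * t.eval g θ + j * u.eval g θ) / (i + j)

namespace Term

/-- Substitution turns a test function into the evaluation of the substituted terms, so the
soundness induction needs these to be continuous again. -/
theorem continuous_eval (t : Term Δ n) {g : Test Δ} (hg : ∀ x, Continuous (g x)) :
    Continuous (t.eval g) := by
  induction t with
  | var x ps => exact (hg x).comp (by fun_prop)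
  | nu i j hi hj t ih =>
    simp only [eval]
    refine continuous_parametric_intervalIntegral_of_continuous' ?_ 0 1
    exact ((continuous_dens i j).comp continuous_snd).mul
      (ih.comp (Continuous.finCons continuous_snd continuous_fst))
  | get p t u iht ihu => simp only [eval]; fun_prop
  | choice i j h t u iht ihu => simp only [eval]; fun_prop

theorem cons_comp_liftRen {n n' : ℕ} (ρ : Fin n → Fin n') (z : ℝ) (θ : Fin n' → ℝ) :
    (fun p => (Fin.cons z θ : Fin (n' + 1) → ℝ) (liftRen ρ p)) =
      (Fin.cons z fun p => θ (ρ p) : Fin (n + 1) → ℝ) := by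
  funext p
  refine Fin.cases ?_ (fun p => ?_) p <;> simp [liftRen]

theorem eval_rename (t : Term Δ n) {n' : ℕ} (ρ : Fin n → Fin n') (g : Test Δ) (θ : Fin n' → ℝ) :
    (t.rename ρ).eval g θ = t.eval g fun p => θ (ρ p) := by
  induction t generalizing n' with
  | var x ps => rfl
  | nu i j hi hj t ih => simp only [rename, eval, ih, cons_comp_liftRen]
  | get p t u iht ihu => simp only [rename, eval, iht, ihu]
  | choice i j h t u iht ihu => simp only [rename, eval, iht, ihu]

theorem eval_subst {k' : ℕ} {Δ' : Fin k' → ℕ} (t : Term Δ n) {n' : ℕ} (ρ : Fin n → Fin n')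
    (σ : (x : Fin k) → Term Δ' (Δ x + n')) (g : Test Δ') (θ : Fin n' → ℝ) :
    (t.subst ρ σ).eval g θ =
      t.eval (fun x y => (σ x).eval g (Fin.append y θ)) fun p => θ (ρ p) := by
  induction t generalizing n' with
  | var x ps =>
    simp only [subst, eval, eval_rename]
    congr 1
    funext p
    refine Fin.addCases (fun p => ?_) (fun p => ?_) p <;> simp
  | nu i j hi hj t ih =>
    have key (m : ℕ) (y : Fin m → ℝ) (z : ℝ) :
        (fun p => (Fin.append y (Fin.cons z θ) : Fin (m + (n' + 1)) → ℝ)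
          ((Fin.append (Fin.castAdd (n' + 1)) (fun p : Fin n' => Fin.natAdd m p.succ) :
            Fin (m + n') → Fin (m + (n' + 1))) p)) = Fin.append y θ := by
      funext p
      refine Fin.addCases (fun p => ?_) (fun p => ?_) p <;> simp
    simp only [subst, eval, ih, cons_comp_liftRen, eval_rename, key]
  | get p t u iht ihu => simp only [subst, eval, iht, ihu]
  | choice i j h t u iht ihu => simp only [subst, eval, iht, ihu]

end Term

theorem integral_dens_comm (i j k l : ℕ) {f : ℝ → ℝ → ℝ} (hf : Continuous (Function.uncurry f)) :
    ∫ z in (0 : ℝ)..1, dens i j z * ∫ w in (0 : ℝ)..1, dens k l w * f z w =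
      ∫ w in (0 : ℝ)..1, dens k l w * ∫ z in (0 : ℝ)..1, dens i j z * f z w := by
  simp only [← integral_const_mul]
  rw [MeasureTheory.intervalIntegral_intervalIntegral_swap]
  · simp only [mul_left_comm]
  · refine (Continuous.continuousOn ?_).integrableOn_compact
      (isCompact_uIcc.prod isCompact_uIcc) |>.mono_set
      (Set.prod_mono Set.uIoc_subset_uIcc Set.uIoc_subset_uIcc)
    exact ((continuous_dens i j).comp continuous_fst).mul
      (((continuous_dens k l).comp continuous_snd).mul hf)

theorem integral_linear {f h : ℝ → ℝ} (hf : Continuous f) (hh : Continuous h) (a b : ℝ) :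
    ∫ z in (0 : ℝ)..1, (a * f z + b * h z) =
      a * (∫ z in (0 : ℝ)..1, f z) + b * ∫ z in (0 : ℝ)..1, h z := by
  rw [integral_add, integral_const_mul, integral_const_mul]
  all_goals exact Continuous.intervalIntegrable (by fun_prop) _ _

theorem BaseEq.eval_eq {t u : Term Δ n} (h : BaseEq t u) {g : Test Δ} (hg : ∀ x, Continuous (g x))
    (θ : Fin n → ℝ) : t.eval g θ = u.eval g θ := by
  have pos {i j : ℕ} (h : 0 < i + j) : (i + j : ℝ) ≠ 0 := by exact_mod_cast h.ne'
  have cont {k : ℕ} {g : Test (vars k 1)} (hg : ∀ x, Continuous (g x)) (x : Fin k) :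
      Continuous fun z : ℝ => g x fun _ => z := (hg x).comp (by fun_prop)
  cases h
  case conv_exchange i j k l hij hkl hik hjl h h' =>
    simp only [Term.eval, Nat.cast_add]
    rw [mul_div_cancel₀ _ (pos hij), mul_div_cancel₀ _ (pos hkl), mul_div_cancel₀ _ (pos hik),
      mul_div_cancel₀ _ (pos hjl)]
    simp only [Matrix.empty_eq]
    congr 1 <;> ring
  case conv_symm i j hij hji =>
    simp only [Term.eval]
    congr 1 <;> ring
  case conv_zero i hi =>
    have := pos hi
    simp only [Term.eval]
    field_simp
    simp [mul_comm]
  case conv_idem i j hij =>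
    have := pos hij
    simp only [Term.eval]
    field_simp
  case comm_get_get =>
    simp only [Term.eval]
    ring
  case comm_nu_nu i j k l hi hj hk hl =>
    simp only [Term.eval]
    rw [integral_dens_comm]
    · congr! 8 with w z
      rename_i a
      fin_cases a <;> rfl
    · exact (hg 0).comp (by fun_prop)
  case comm_nu_get i j hi hj =>
    simp [Term.eval]
    rw [← integral_linear]
    · congr! 2
      ring
    all_goals exact (continuous_dens _ _).mul (cont hg _)
  case comm_nu_choice i j k l hi hj hkl =>
    simp [Term.eval]
    rw [← integral_linear, ← integral_div]
    · congr! 2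
      ring
    all_goals exact (continuous_dens _ _).mul (cont hg _)
  case comm_get_choice i j hij =>
    simp only [Term.eval]
    ring
  case discard_nu i j hi hj =>
    have e (z : ℝ) : (fun a => (Fin.cons z θ : Fin 1 → ℝ) (![] a)) = fun a => θ (![] a) := by
      funext a
      exact a.elim0
    simp only [Term.eval, e]
    rw [integral_mul_const, integral_dens, one_mul]
  case discard_get =>
    simp only [Term.eval]
    ring
  case conjugacy i j hi hj hi' hj' hij =>
    simp [Term.eval]
    rw [← integral_linear, ← integral_div]
    · congr 1
      funext z
      have h₁ := dens_mul_self hi hj z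
      have h₂ := dens_mul_one_sub hi hj z
      linear_combination g 0 (fun _ => z) * h₁ + g 1 (fun _ => z) * h₂
    all_goals exact (continuous_dens _ _).mul (cont hg _)

/-- Soundness: derivably equal terms have the same expected values. -/
theorem Derivable.eval_eq {t u : Term Δ n} (h : Derivable t u) {g : Test Δ}
    (hg : ∀ x, Continuous (g x)) (θ : Fin n → ℝ) : t.eval g θ = u.eval g θ := by
  induction h with
  | base h => exact h.eval_eq hg θ
  | subst ρ σ _ ih =>
    rw [Term.eval_subst, Term.eval_subst]
    exact ih (fun x => ((σ x).continuous_eval hg).comp (by fun_prop)) _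
  | refl t => rfl
  | symm _ ih => exact (ih hg θ).symm
  | trans _ _ ih₁ ih₂ => exact (ih₁ hg θ).trans (ih₂ hg θ)
  | nu i j hi hj _ ih => simp only [Term.eval, ih hg]
  | get p _ _ ih₁ ih₂ => simp only [Term.eval, ih₁ hg, ih₂ hg]
  | choice i j h _ _ ih₁ ih₂ => simp only [Term.eval, ih₁ hg, ih₂ hg]

end BetaBernoulli

/-! ### Combinatorial description of chains -/

namespace BetaBernoulli

variable {k : ℕ} {Δ : Fin k → ℕ} {n : ℕ}

/-- A description of the bound parameters of a chain: to each of them a number `i < r`, standing for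
the binder `ν_{i+1,r-i}`, and the set of those argument positions of the variable where it is
used. -/
abbrev Blocks (r m : ℕ) : Type := List (Fin r × Finset (Fin m))

/-- The positions used by different bound parameters are disjoint, and every bound parameter is
used. -/
structure Blocks.Good {r m : ℕ} (l : Blocks r m) : Prop where
  disj : l.Pairwise fun c d => Disjoint c.2 d.2
  nonempty : ∀ c ∈ l, c.2.Nonempty

/-- The chain described by blocks; the positions outside of the blocks are filled by free
parameters. -/
def Term.chain (x : Fin k) {r : ℕ} :
    Blocks r (Δ x) → {n : ℕ} → (Fin (Δ x) → Fin n) → Term Δ n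
  | [], _, ps => .var x ps
  | c :: l, _, ps => .nu (c.1 + 1) (r - c.1) (Nat.succ_pos _) (Nat.sub_pos_of_lt c.1.2)
      (Term.chain x l fun a => if a ∈ c.2 then 0 else (ps a).succ)

namespace Term

variable {x : Fin k} {r : ℕ}

theorem rename_chain (l : Blocks r (Δ x)) (ps : Fin (Δ x) → Fin n) {n' : ℕ} (ρ : Fin n → Fin n') :
    (chain x l ps).rename ρ = chain x l fun a => ρ (ps a) := by
  induction l generalizing n n' with
  | nil => rfl
  | cons c l ih =>
    simp only [chain, rename, ih]
    congr! 3 with a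
    split_ifs <;> simp [liftRen]

theorem chain_congr {l : Blocks r (Δ x)} {ps ps' : Fin (Δ x) → Fin n}
    (h : ∀ a, (∀ c ∈ l, a ∉ c.2) → ps a = ps' a) : chain x l ps = chain x l ps' := by
  induction l generalizing n with
  | nil => exact congrArg _ (funext fun a => h a (by simp))
  | cons c l ih =>
    simp only [chain]
    rw [ih fun a ha => ?_]
    split_ifs with hc
    · rfl
    · rw [h a (by simpa [hc] using ha)]

theorem chain_swap (c d : Fin r × Finset (Fin (Δ x))) (l : Blocks r (Δ x))
    (h : Disjoint c.2 d.2) (ps : Fin (Δ x) → Fin n) :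
    Cls.mk (chain x (c :: d :: l) ps) = Cls.mk (chain x (d :: c :: l) ps) := by
  refine (Cls.nu_nu _ _ _ _ (Nat.succ_pos _) (Nat.sub_pos_of_lt c.1.2) (Nat.succ_pos _)
    (Nat.sub_pos_of_lt d.1.2) _).trans ?_
  rw [rename_chain]
  refine congrArg (fun ps => Cls.mk (.nu _ _ _ _ (.nu _ _ _ _ (chain x l ps))))
    (funext fun a => ?_)
  by_cases hc : a ∈ c.2
  · simp [hc, Finset.disjoint_left.1 h hc]
  · by_cases hd : a ∈ d.2
    · simp [hc, hd]
    · simp only [hc, hd, if_false]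
      exact Equiv.swap_apply_of_ne_of_ne (Fin.succ_ne_zero _)
        (fun e => Fin.succ_ne_zero _ (Fin.succ_injective _ e))

theorem chain_perm {l l' : Blocks r (Δ x)} (h : l.Perm l')
    (hl : l.Pairwise fun c d => Disjoint c.2 d.2) (ps : Fin (Δ x) → Fin n) :
    Cls.mk (chain x l ps) = Cls.mk (chain x l' ps) := by
  induction h generalizing n with
  | nil => rfl
  | cons c _ ih => exact congrArg (Cls.nu _ _ _ _) (ih hl.tail _)
  | swap c d l => exact chain_swap _ _ _ (List.rel_of_pairwise_cons hl (by simp)) _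
  | trans h₁ _ ih₁ ih₂ =>
    exact (ih₁ hl ps).trans (ih₂ ((h₁.pairwise_iff fun h => h.symm).1 hl) ps)

end Term

/-- Discardability removes the binders whose parameter is not used. Inside the blocks `ps` carries
no information and is given the default value `z`. -/
theorem Cls.IsChain.exists_eq_chain {r : ℕ} {c : Cls Δ n} (h : IsChain r c) (z : Fin n) :
    ∃ (x : Fin k) (l : Blocks r (Δ x)) (ps : Fin (Δ x) → Fin n), l.Good ∧
      (∀ d ∈ l, ∀ a ∈ d.2, ps a = z) ∧ c = mk (.chain x l ps) := by
  induction h with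
  | var x ps => exact ⟨x, [], ps, ⟨.nil, by simp⟩, by simp, rfl⟩
  | nu i j hi hj h _ ih =>
    -- With default `z.succ`, the value `0` occurs only where the newly bound parameter is really
    -- used, so its block is disjoint from the others.
    obtain ⟨x, l, ps, hl, hps, rfl⟩ := ih z.succ
    let S : Finset (Fin (Δ x)) := {a | ps a = 0}
    let ps' : Fin (Δ x) → Fin _ := fun a => Fin.cases z id (ps a)
    have hS (a) (ha : ps a = 0) : ps' a = z := by simp [ps', ha]
    have hS' (a) (ha : ps a ≠ 0) : (ps' a).succ = ps a := by
      obtain ⟨p, hp⟩ := Fin.exists_succ_eq.2 ha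
      simp [ps', ← hp]
    have hmem (a) : a ∈ S ↔ ps a = 0 := by simp [S]
    have hz (d) (hd : d ∈ l) (a) (ha : a ∈ d.2) : ps' a = z := by simp [ps', hps d hd a ha]
    rcases S.eq_empty_or_nonempty with he | hne
    · refine ⟨x, l, ps', hl, hz, ?_⟩
      refine Eq.trans ?_ (nu_weaken i j hi hj _)
      rw [Term.rename_chain]
      refine congrArg (fun ps => Cls.nu i j hi hj (mk (.chain x l ps))) (funext fun a => ?_)
      refine (hS' a fun h0 => ?_).symm
      exact Finset.notMem_empty a (he ▸ (hmem a).2 h0)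
    · refine ⟨x, (⟨i - 1, by omega⟩, S) :: l, ps', ⟨.cons (fun d hd => ?_) hl.disj, ?_⟩, ?_, ?_⟩
      · refine Finset.disjoint_left.2 fun a ha had => ?_
        have := (hmem a).1 ha
        rw [hps d hd a had] at this
        exact Fin.succ_ne_zero _ this
      · rintro d (_ | ⟨_, hd⟩)
        exacts [hne, hl.nonempty d hd]
      · rintro d (_ | ⟨_, hd⟩)
        exacts [fun a ha => hS a ((hmem a).1 ha), hz d hd]
      · have e : (fun a => if a ∈ S then 0 else (ps' a).succ) = ps := by
          funext a
          by_cases ha : ps a = 0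
          · rw [if_pos ((hmem a).2 ha), ha]
          · rw [if_neg fun h => ha ((hmem a).1 h), hS' a ha]
        simp only [Term.chain, e]
        obtain ⟨i, rfl⟩ := Nat.exists_eq_add_of_lt hi
        obtain rfl : j = r - (0 + i + 1 - 1) := by omega
        congr! 2

namespace Blocks

variable {r m : ℕ}

/-- What stands at a position: a free parameter or a block. -/
def label : Blocks r m → (Fin m → Fin n) → Fin m → Fin n ⊕ Finset (Fin m)
  | [], ps, a => .inl (ps a)
  | c :: l, ps, a => if a ∈ c.2 then .inr c.2 else label l ps a

theorem label_eq_inr {l : Blocks r m} (hl : l.Good) {ps : Fin m → Fin n} {a : Fin m}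
    {S : Finset (Fin m)} : label l ps a = .inr S ↔ ∃ c ∈ l, c.2 = S ∧ a ∈ S := by
  induction l with
  | nil => simp [label]
  | cons c l ih =>
    have hd := (List.pairwise_cons.1 hl.disj).1
    rw [label]
    split_ifs with h
    · constructor
      · rintro ⟨⟩
        exact ⟨c, by simp, rfl, h⟩
      · rintro ⟨d, hdl, rfl, had⟩
        rcases List.mem_cons.1 hdl with rfl | hdl
        · rfl
        · exact absurd had (Finset.disjoint_left.1 (hd d hdl) h)
    · rw [ih ⟨hl.disj.tail, fun d hd => hl.nonempty d (by simp [hd])⟩]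
      constructor
      · rintro ⟨d, hdl, h⟩
        exact ⟨d, by simp [hdl], h⟩
      · rintro ⟨d, hdl, rfl, had⟩
        rcases List.mem_cons.1 hdl with rfl | hdl
        · exact absurd had h
        · exact ⟨d, hdl, rfl, had⟩

theorem label_eq_inl {l : Blocks r m} {ps : Fin m → Fin n} {a : Fin m} {p : Fin n} :
    label l ps a = .inl p ↔ (∀ c ∈ l, a ∉ c.2) ∧ ps a = p := by
  induction l with
  | nil => simp [label]
  | cons c l ih =>
    rw [label]
    split_ifs with h <;> simp [h, ih]

/-- A block is the set of positions sharing the label of one of its elements, so the pattern of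
equal labels recovers it. -/
theorem label_eq_of_iff {l l' : Blocks r m} (hl : l.Good) (hl' : l'.Good) {ps ps' : Fin m → Fin n}
    (h₁ : ∀ a b, label l ps a = label l ps b ↔ label l' ps' a = label l' ps' b)
    (h₂ : ∀ a p, label l ps a = .inl p ↔ label l' ps' a = .inl p) : label l ps = label l' ps' := by
  funext a
  rcases h : label l ps a with p | S
  · exact ((h₂ a p).1 h).symm
  rcases h' : label l' ps' a with p | S'
  · exact absurd ((h₂ a p).2 h') (by simp [h])
  obtain ⟨c, hc, rfl, hac⟩ := (label_eq_inr hl).1 h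
  obtain ⟨c', hc', rfl, hac'⟩ := (label_eq_inr hl').1 h'
  have e (b) : b ∈ c.2 ↔ b ∈ c'.2 := by
    have e₁ : label l ps b = .inr c.2 ↔ b ∈ c.2 := (label_eq_inr hl).trans
      ⟨fun ⟨_, _, _, hb⟩ => hb, fun hb => ⟨c, hc, rfl, hb⟩⟩
    have e₂ : label l' ps' b = .inr c'.2 ↔ b ∈ c'.2 := (label_eq_inr hl').trans
      ⟨fun ⟨_, _, _, hb⟩ => hb, fun hb => ⟨c', hc', rfl, hb⟩⟩
    rw [← e₁, ← e₂, ← h, ← h', h₁]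
  rw [Finset.ext e]

theorem Good.nodup_map_snd {l : Blocks r m} (hl : l.Good) : (l.map Prod.snd).Nodup := by
  refine List.pairwise_map.2 ((List.Pairwise.and_mem.1 hl.disj).imp fun ⟨hc, _, h⟩ e => ?_)
  obtain ⟨a, ha⟩ := hl.nonempty _ hc
  exact Finset.disjoint_left.1 h ha (e ▸ ha)

theorem Good.eq_of_snd_eq {l : Blocks r m} (hl : l.Good) {c d} (hc : c ∈ l) (hd : d ∈ l)
    (h : c.2 = d.2) : c = d :=
  List.inj_on_of_nodup_map hl.nodup_map_snd hc hd h

theorem map_snd_perm {l l' : Blocks r m} (hl : l.Good) (hl' : l'.Good) {ps ps' : Fin m → Fin n}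
    (h : label l ps = label l' ps') : (l.map Prod.snd).Perm (l'.map Prod.snd) := by
  refine (List.perm_ext_iff_of_nodup hl.nodup_map_snd hl'.nodup_map_snd).2 fun S => ?_
  have key {l : Blocks r m} (hl : l.Good) (ps : Fin m → Fin n) :
      S ∈ l.map Prod.snd ↔ ∃ a, label l ps a = .inr S := by
    simp only [label_eq_inr hl, List.mem_map]
    constructor
    · rintro ⟨c, hc, rfl⟩
      obtain ⟨a, ha⟩ := hl.nonempty c hc
      exact ⟨a, c, hc, rfl, ha⟩
    · rintro ⟨_, c, hc, rfl, _⟩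
      exact ⟨c, hc, rfl⟩
  rw [key hl ps, key hl' ps', h]

end Blocks

end BetaBernoulli

/-! ### Moments, and functions dual to the Beta densities -/

namespace BetaBernoulli

open intervalIntegral

theorem eq_zero_of_integral_mul_self {f : ℝ → ℝ} (hf : Continuous f)
    (h : ∫ z in (0 : ℝ)..1, f z * f z = 0) {z : ℝ} (hz : z ∈ Set.Icc (0 : ℝ) 1) : f z = 0 := by
  by_contra hne
  refine (integral_pos one_pos (hf.mul hf).continuousOn (fun _ _ => mul_self_nonneg _)
    ⟨z, hz, ?_⟩).ne' h
  exact mul_self_pos.2 hne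

/-- A continuous function on `[0, 1]` all of whose moments vanish is zero. -/
theorem eq_zero_of_moments {f : ℝ → ℝ} (hf : Continuous f)
    (h : ∀ a : ℕ, ∫ z in (0 : ℝ)..1, z ^ a * f z = 0) {z : ℝ} (hz : z ∈ Set.Icc (0 : ℝ) 1) :
    f z = 0 := by
  have hp (p : Polynomial ℝ) : ∫ z in (0 : ℝ)..1, p.eval z * f z = 0 := by
    have e (z : ℝ) : p.eval z * f z =
        ∑ i ∈ Finset.range (p.natDegree + 1), p.coeff i * (z ^ i * f z) := by
      rw [Polynomial.eval_eq_sum_range, Finset.sum_mul]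
      simp only [mul_assoc]
    simp only [e]
    rw [integral_finsetSum fun i _ => Continuous.intervalIntegrable (by fun_prop) _ _]
    simp [integral_const_mul, h]
  refine eq_zero_of_integral_mul_self hf ?_ hz
  have hK : 0 ≤ ∫ z in (0 : ℝ)..1, |f z| := integral_nonneg zero_le_one fun _ _ => abs_nonneg _
  refine le_antisymm (le_of_forall_pos_le_add fun ε hε => ?_)
    (integral_nonneg zero_le_one fun _ _ => mul_self_nonneg _)
  set K := ∫ z in (0 : ℝ)..1, |f z| with hKdef
  -- Since `f` is orthogonal to `p`, the integral of `f * f` is that of `(f - p) * f`, at most `ε *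
  -- K / (K + 1)`. The `+ 1` covers `K = 0`.
  obtain ⟨p, hp'⟩ := exists_polynomial_near_of_continuousOn 0 1 f hf.continuousOn (ε / (K + 1))
    (by positivity)
  have e : ∫ z in (0 : ℝ)..1, f z * f z = ∫ z in (0 : ℝ)..1, (f z - p.eval z) * f z := by
    simp only [sub_mul]
    rw [integral_sub, hp, sub_zero]
    all_goals exact Continuous.intervalIntegrable (by fun_prop) _ _
  calc ∫ z in (0 : ℝ)..1, f z * f z
      ≤ ∫ z in (0 : ℝ)..1, ε / (K + 1) * |f z| := by
        rw [e]
        refine integral_mono_on zero_le_one (Continuous.intervalIntegrable (by fun_prop) _ _)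
          (Continuous.intervalIntegrable (by fun_prop) _ _) fun z hz => ?_
        refine (le_abs_self _).trans ?_
        rw [abs_mul, abs_sub_comm]
        exact mul_le_mul_of_nonneg_right (hp' z hz).le (abs_nonneg _)
    _ = ε * (K / (K + 1)) := by rw [integral_const_mul, ← hKdef]; ring
    _ ≤ ε * 1 := by gcongr; exact div_le_one_of_le₀ (by linarith) (by linarith)
    _ = 0 + ε := by ring

/-- Setting `z = s / (1 + s)` and multiplying by `(1 + s) ^ (r - 1)` turns the relation into a
polynomial in `s` that vanishes for all `s > 0`. -/
theorem dens_linearIndependent {r : ℕ} (c : Fin r → ℝ)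
    (h : ∀ z ∈ Set.Icc (0 : ℝ) 1, ∑ i, c i * dens (i + 1) (r - i) z = 0) : c = 0 := by
  let p : Polynomial ℝ := ∑ i : Fin r,
    Polynomial.monomial i (c i / betaInt i (r - i - 1))
  have hp : p = 0 := by
    refine Polynomial.eq_zero_of_infinite_isRoot p ((Set.Ioi_infinite (0 : ℝ)).mono fun s hs => ?_)
    have hs : 0 < s := hs
    have hz := h (s / (1 + s)) ⟨by positivity, by rw [div_le_one (by positivity)]; linarith⟩
    rw [Set.mem_ofPred_eq, Polynomial.IsRoot.def, Polynomial.eval_finsetSum]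
    rw [← mul_zero ((1 + s) ^ (r - 1)), ← hz, Finset.mul_sum]
    refine Finset.sum_congr rfl fun i _ => ?_
    obtain ⟨d, hd⟩ : ∃ d, r = i + d + 1 := ⟨r - i - 1, by omega⟩
    have e : 1 - s / (1 + s) = 1 / (1 + s) := by field_simp; ring
    rw [Polynomial.eval_monomial, dens, e]
    simp only [Nat.add_sub_cancel, hd, show (i : ℕ) + d + 1 - i - 1 = d by omega]
    have := betaInt_pos i d
    rw [div_pow, div_pow, one_pow, pow_add]
    field_simp
  funext i
  have h₁ : p.coeff i = 0 := by rw [hp, Polynomial.coeff_zero]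
  rw [Polynomial.finsetSum_coeff, Finset.sum_eq_single i] at h₁
  · rw [Polynomial.coeff_monomial_same, div_eq_zero_iff] at h₁
    exact h₁.resolve_right (betaInt_pos _ _).ne'
  · intro j _ hj
    exact Polynomial.coeff_monomial_of_ne _ fun e => hj (Fin.ext e.symm)
  · simp

/-- Functions dual to the Beta distributions of a given total weight. -/
theorem exists_dual_dens (r : ℕ) : ∃ f : Fin r → ℝ → ℝ, (∀ i, Continuous (f i)) ∧
    ∀ i j : Fin r, ∫ z in (0 : ℝ)..1, dens (i + 1) (r - i) z * f j z = if i = j then 1 else 0 := by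
  let b (i : Fin r) : ℝ → ℝ := dens (i + 1) (r - i)
  have hb (i) : Continuous (b i) := continuous_dens _ _
  -- The Gram matrix of the densities is invertible by linear independence; the columns of its
  -- inverse are the coefficients of the dual functions.
  let A : Matrix (Fin r) (Fin r) ℝ := .of fun i j => ∫ z in (0 : ℝ)..1, b i z * b j z
  have hA (i : Fin r) (c : Fin r → ℝ) :
      ∫ z in (0 : ℝ)..1, b i z * ∑ j, c j * b j z = ∑ j, A i j * c j := by
    simp only [Finset.mul_sum]
    rw [integral_finsetSum fun j _ => Continuous.intervalIntegrable (by fun_prop) _ _]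
    refine Finset.sum_congr rfl fun j _ => ?_
    refine Eq.trans ?_ (integral_mul_const (c j) _)
    simp only [mul_assoc, mul_comm (c j)]
  have hinj : Function.Injective A.mulVec := by
    refine (injective_iff_map_eq_zero A.mulVecLin).2 fun c hc => ?_
    refine dens_linearIndependent c fun z hz => ?_
    refine eq_zero_of_integral_mul_self (f := fun z => ∑ i, c i * b i z) (by fun_prop) ?_ hz
    simp only [Finset.sum_mul]
    rw [integral_finsetSum fun j _ => Continuous.intervalIntegrable (by fun_prop) _ _]
    refine Finset.sum_eq_zero fun i _ => ?_
    simp only [mul_assoc]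
    rw [integral_const_mul, hA]
    exact mul_eq_zero_of_right _ (congrFun hc i)
  obtain ⟨C, hC⟩ := (Matrix.mulVec_injective_iff_isUnit.1 hinj).exists_right_inv
  refine ⟨fun j z => ∑ l, C l j * b l z, fun j => by fun_prop, fun i j => ?_⟩
  rw [hA i fun l => C l j, ← Matrix.one_apply, ← hC, Matrix.mul_apply]

end BetaBernoulli

/-! ### Random filling of blocks, generic points and limits of continuous functions -/

namespace BetaBernoulli

variable {k : ℕ} {Δ : Fin k → ℕ} {n : ℕ}

open intervalIntegral Filter Topology

/-- The cube `[0, 1]ᵐ`. -/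
def cube (m : ℕ) : Set (Fin m → ℝ) := Set.univ.pi fun _ => Set.Icc 0 1

theorem isCompact_cube (m : ℕ) : IsCompact (cube m) := isCompact_univ_pi fun _ => isCompact_Icc

namespace Blocks

variable {r m : ℕ}

/-- Filling a set of positions with the same number. -/
def fill (S : Finset (Fin m)) (z : ℝ) (y : Fin m → ℝ) : Fin m → ℝ := fun a => if a ∈ S then z else y a

theorem fill_mem_cube {S : Finset (Fin m)} {z : ℝ} {y : Fin m → ℝ} (hz : z ∈ Set.Icc (0 : ℝ) 1)
    (hy : y ∈ cube m) : fill S z y ∈ cube m := by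
  intro a _
  unfold fill
  split_ifs
  exacts [hz, hy a trivial]

theorem continuous_fill (S : Finset (Fin m)) :
    Continuous fun p : (Fin m → ℝ) × ℝ => fill S p.2 p.1 := by
  refine continuous_pi fun a => ?_
  unfold fill
  split_ifs <;> fun_prop

/-- The expected value of a function when the blocks are filled with independent random numbers
with Beta distributions. -/
noncomputable def mean (f : (Fin m → ℝ) → ℝ) : Blocks r m → (Fin m → ℝ) → ℝ
  | [], y => f y
  | c :: l, y => ∫ z in (0 : ℝ)..1, dens (c.1 + 1) (r - c.1) z * mean f l (fill c.2 z y)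

theorem _root_.BetaBernoulli.Term.eval_chain {x : Fin k} (l : Blocks r (Δ x))
    (ps : Fin (Δ x) → Fin n) (g : Test Δ) (θ : Fin n → ℝ) :
    (Term.chain x l ps).eval g θ = l.mean (g x) fun a => θ (ps a) := by
  induction l generalizing n with
  | nil => rfl
  | cons c l ih =>
    simp only [Term.chain, Term.eval, ih, mean]
    congr! 5 with z
    rename_i a
    unfold fill
    split_ifs <;> simp

theorem continuous_mean {f : (Fin m → ℝ) → ℝ} (hf : Continuous f) (l : Blocks r m) :
    Continuous (mean f l) := by
  induction l with
  | nil => exact hf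
  | cons c l ih =>
    refine continuous_parametric_intervalIntegral_of_continuous' ?_ 0 1
    exact ((continuous_dens _ _).comp continuous_snd).mul (ih.comp (continuous_fill c.2))

theorem continuous_mean_fill {f : (Fin m → ℝ) → ℝ} (hf : Continuous f) (l : Blocks r m)
    (S : Finset (Fin m)) (y : Fin m → ℝ) : Continuous fun z => mean f l (fill S z y) :=
  (continuous_mean hf l).comp ((continuous_fill S).comp (by fun_prop : Continuous fun z => (y, z)))

theorem abs_mean_le {f : (Fin m → ℝ) → ℝ} (hf : Continuous f) {C : ℝ}
    (hC : ∀ y ∈ cube m, |f y| ≤ C) (l : Blocks r m) {y : Fin m → ℝ} (hy : y ∈ cube m) :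
    |mean f l y| ≤ C := by
  induction l generalizing y with
  | nil => exact hC y hy
  | cons c l ih =>
    rw [mean]
    have e : ∫ z in (0 : ℝ)..1, dens (c.1 + 1) (r - c.1) z * C = C := by
      rw [integral_mul_const, integral_dens, one_mul]
    refine (abs_integral_le_integral_abs zero_le_one).trans (le_trans ?_ e.le)
    have hcont := continuous_mean_fill hf l c.2 y
    have h₁ := ((continuous_dens (c.1 + 1) (r - c.1)).mul hcont).abs
    have h₂ := (continuous_dens (c.1 + 1) (r - c.1)).mul (continuous_const (y := C))
    refine integral_mono_on zero_le_one (h₁.intervalIntegrable (μ := MeasureTheory.volume) _ _)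
      (h₂.intervalIntegrable (μ := MeasureTheory.volume) _ _) fun z hz => ?_
    have hd := dens_nonneg (c.1 + 1) (r - c.1) hz.1 hz.2
    rw [abs_mul, abs_of_nonneg hd]
    exact mul_le_mul_of_nonneg_left (ih (fill_mem_cube hz hy)) hd

theorem mem_Icc_of_mem_uIoc {z : ℝ} (hz : z ∈ Set.uIoc (0 : ℝ) 1) : z ∈ Set.Icc (0 : ℝ) 1 := by
  rw [Set.uIoc_of_le zero_le_one] at hz
  exact ⟨hz.1.le, hz.2⟩

theorem tendsto_mean {F : ℕ → (Fin m → ℝ) → ℝ} {f : (Fin m → ℝ) → ℝ} (hF : ∀ N, Continuous (F N))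
    {C : ℝ} (hC : ∀ N, ∀ y ∈ cube m, |F N y| ≤ C)
    (h : ∀ y ∈ cube m, Tendsto (fun N => F N y) atTop (𝓝 (f y))) (l : Blocks r m) {y : Fin m → ℝ}
    (hy : y ∈ cube m) : Tendsto (fun N => mean (F N) l y) atTop (𝓝 (mean f l y)) := by
  induction l generalizing y with
  | nil => exact h y hy
  | cons c l ih =>
    have hcont (N) := continuous_mean_fill (hF N) l c.2 y
    refine tendsto_integral_filter_of_dominated_convergence
      (fun z => dens (c.1 + 1) (r - c.1) z * C) (.of_forall fun N => ?_)
      (.of_forall fun N => .of_forall fun z hz => ?_) ?_ (.of_forall fun z hz => ?_)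
    · exact Continuous.aestronglyMeasurable (by fun_prop)
    · have hz := mem_Icc_of_mem_uIoc hz
      have hd := dens_nonneg (c.1 + 1) (r - c.1) hz.1 hz.2
      rw [Real.norm_eq_abs, abs_mul, abs_of_nonneg hd]
      exact mul_le_mul_of_nonneg_left (abs_mean_le (hF N) (hC N) l (fill_mem_cube hz hy)) hd
    · exact Continuous.intervalIntegrable (by fun_prop) _ _
    · exact (ih (fill_mem_cube (mem_Icc_of_mem_uIoc hz) hy)).const_mul _

theorem mean_const_mul (b : ℝ) (f : (Fin m → ℝ) → ℝ) (l : Blocks r m) (y : Fin m → ℝ) :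
    mean (fun y => b * f y) l y = b * mean f l y := by
  induction l generalizing y with
  | nil => rfl
  | cons c l ih =>
    simp only [mean, ih]
    rw [← integral_const_mul]
    simp only [mul_left_comm]

/-- `l.Generic F y y'` says that `y'` arises from `y` by filling the blocks with distinct numbers
outside of `F`. -/
def Generic (F : Finset ℝ) : Blocks r m → (Fin m → ℝ) → (Fin m → ℝ) → Prop
  | [], y, y' => y' = y
  | c :: l, y, y' => ∃ z ∉ F, Generic (insert z F) l (fill c.2 z y) y'

/-- Beta distributions have no atoms, so at each integration the finitely many forbidden numbers
form a null set. -/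
theorem mean_congr {f g : (Fin m → ℝ) → ℝ} {l : Blocks r m} (F : Finset ℝ) {y : Fin m → ℝ}
    (h : ∀ y', Generic F l y y' → f y' = g y') : mean f l y = mean g l y := by
  induction l generalizing F y with
  | nil => exact h y rfl
  | cons c l ih =>
    refine integral_congr_ae ?_
    filter_upwards [MeasureTheory.compl_mem_ae_iff.2 (F.finite_toSet.measure_zero _)] with z hz _
    rw [ih (insert z F) fun y' hy' => h y' ⟨z, hz, hy'⟩]

namespace Generic

variable {F : Finset ℝ} {l : Blocks r m} {y y' : Fin m → ℝ}

theorem eq_of_notMem (h : Generic F l y y') {a : Fin m} (ha : ∀ c ∈ l, a ∉ c.2) : y' a = y a := by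
  induction l generalizing F y with
  | nil => rw [h]
  | cons c l ih =>
    obtain ⟨z, hz, h⟩ := h
    rw [ih h fun d hd => ha d (by simp [hd]), fill, if_neg (ha c (by simp))]

theorem eq_of_mem (h : Generic F l y y') (hl : l.Good) {c} (hc : c ∈ l) {a b : Fin m}
    (ha : a ∈ c.2) (hb : b ∈ c.2) : y' a = y' b := by
  induction l generalizing F y with
  | nil => simp at hc
  | cons d l ih =>
    obtain ⟨z, hz, h⟩ := h
    have hd := (List.pairwise_cons.1 hl.disj).1
    rcases List.mem_cons.1 hc with rfl | hc
    · rw [h.eq_of_notMem fun e he => Finset.disjoint_left.1 (hd e he) ha,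
        h.eq_of_notMem fun e he => Finset.disjoint_left.1 (hd e he) hb, fill, fill, if_pos ha,
        if_pos hb]
    · exact ih h ⟨hl.disj.tail, fun e he => hl.nonempty e (by simp [he])⟩ hc

theorem notMem_of_mem (h : Generic F l y y') (hl : l.Good) {c} (hc : c ∈ l) {a : Fin m}
    (ha : a ∈ c.2) : y' a ∉ F := by
  induction l generalizing F y with
  | nil => simp at hc
  | cons d l ih =>
    obtain ⟨z, hz, h⟩ := h
    have hd := (List.pairwise_cons.1 hl.disj).1
    rcases List.mem_cons.1 hc with rfl | hc
    · rwa [h.eq_of_notMem fun e he => Finset.disjoint_left.1 (hd e he) ha, fill, if_pos ha]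
    · exact fun hF => ih h ⟨hl.disj.tail, fun e he => hl.nonempty e (by simp [he])⟩ hc
        (Finset.mem_insert_of_mem hF)

theorem ne_of_mem (h : Generic F l y y') (hl : l.Good) {c d} (hc : c ∈ l) (hd : d ∈ l)
    (hcd : c.2 ≠ d.2) {a b : Fin m} (ha : a ∈ c.2) (hb : b ∈ d.2) : y' a ≠ y' b := by
  induction l generalizing F y c d a b with
  | nil => simp at hc
  | cons e l ih =>
    obtain ⟨z, hz, h⟩ := h
    have he := (List.pairwise_cons.1 hl.disj).1
    have hl' : Good l := ⟨hl.disj.tail, fun e he => hl.nonempty e (by simp [he])⟩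
    have key {a b : Fin m} {d} (hd : d ∈ l) (ha : a ∈ e.2) (hb : b ∈ d.2) : y' a ≠ y' b := by
      intro hab
      refine h.notMem_of_mem hl' hd hb (hab ▸ ?_)
      rw [h.eq_of_notMem fun d hd => Finset.disjoint_left.1 (he d hd) ha, fill, if_pos ha]
      exact Finset.mem_insert_self _ _
    rcases List.mem_cons.1 hc with rfl | hc'
    · rcases List.mem_cons.1 hd with rfl | hd'
      · exact absurd rfl hcd
      · exact key hd' ha hb
    · rcases List.mem_cons.1 hd with rfl | hd'
      · exact (key hc' hb ha).symm
      · exact ih h hl' hc' hd' hcd ha hb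

variable {θ : Fin n → ℝ} {ps : Fin m → Fin n}

/-- With the parameter values as forbidden set, a generic point reveals its labels: here the free
parameters, in `eq_iff` the pattern of equalities. -/
theorem eq_param_iff (h : Generic (Finset.univ.image θ) l (fun a => θ (ps a)) y')
    (hθ : Function.Injective θ) (hl : l.Good) (a : Fin m) (p : Fin n) :
    y' a = θ p ↔ label l ps a = .inl p := by
  by_cases ha : ∀ c ∈ l, a ∉ c.2
  · rw [h.eq_of_notMem ha, hθ.eq_iff, label_eq_inl]
    exact (and_iff_right ha).symm
  · rw [label_eq_inl]
    push Not at ha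
    obtain ⟨c, hc, hac⟩ := ha
    refine iff_of_false (fun e => ?_) fun e => e.1 c hc hac
    exact h.notMem_of_mem hl hc hac (e ▸ Finset.mem_image_of_mem _ (Finset.mem_univ _))

theorem eq_iff (h : Generic (Finset.univ.image θ) l (fun a => θ (ps a)) y')
    (hθ : Function.Injective θ) (hl : l.Good) (a b : Fin m) :
    y' a = y' b ↔ label l ps a = label l ps b := by
  rcases ha : label l ps a with p | S
  · rw [(h.eq_param_iff hθ hl a p).2 ha, eq_comm, h.eq_param_iff hθ hl b p, eq_comm]
  rcases hb : label l ps b with p | T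
  · rw [(h.eq_param_iff hθ hl b p).2 hb, h.eq_param_iff hθ hl a p, ha]
  obtain ⟨c, hc, rfl, hac⟩ := (label_eq_inr hl).1 ha
  obtain ⟨d, hd, rfl, hbd⟩ := (label_eq_inr hl).1 hb
  rw [Sum.inr.injEq]
  refine ⟨fun e => by_contra fun hne => h.ne_of_mem hl hc hd hne hac hbd e, fun e => ?_⟩
  exact h.eq_of_mem hl hc hac (e ▸ hbd)

end Generic

open Classical in
/-- The value at some position in a set. -/
noncomputable def rep (S : Finset (Fin m)) (y : Fin m → ℝ) : ℝ :=
  if h : S.Nonempty then y h.choose else 0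

theorem continuous_rep (S : Finset (Fin m)) : Continuous (rep S) := by
  unfold rep
  split_ifs <;> fun_prop

theorem exists_rep_eq {S : Finset (Fin m)} (h : S.Nonempty) : ∃ a ∈ S, ∀ y, rep S y = y a :=
  ⟨h.choose, h.choose_spec, fun _ => dif_pos h⟩

/-- Distinct blocks are filled independently, and each factor reads only its own block. -/
theorem mean_prod {l : Blocks r m} (hl : l.Good) (h : Finset (Fin m) → ℝ → ℝ) (y : Fin m → ℝ) :
    mean (fun y => (l.map fun c => h c.2 (rep c.2 y)).prod) l y =
      (l.map fun c => ∫ z in (0 : ℝ)..1, dens (c.1 + 1) (r - c.1) z * h c.2 z).prod := by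
  induction l generalizing y with
  | nil => rfl
  | cons c l ih =>
    have hc := (List.pairwise_cons.1 hl.disj).1
    obtain ⟨a, hac, ha⟩ := exists_rep_eq (hl.nonempty c (by simp))
    rw [mean, List.map_cons, List.prod_cons, ← integral_mul_const]
    congr 1
    funext z
    have e (y') (hy' : Generic ∅ l (fill c.2 z y) y') :
        ((c :: l).map fun c => h c.2 (rep c.2 y')).prod =
          h c.2 z * (l.map fun c => h c.2 (rep c.2 y')).prod := by
      rw [List.map_cons, List.prod_cons, ha,
        hy'.eq_of_notMem fun d hd => Finset.disjoint_left.1 (hc d hd) hac, fill, if_pos hac]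
    rw [mean_congr ∅ e, mean_const_mul,
      ih ⟨hl.disj.tail, fun e he => hl.nonempty e (by simp [he])⟩]
    ring

end Blocks

/-- Bounded pointwise limits, on the cube, of continuous functions. -/
def IsLim {m : ℕ} (f : (Fin m → ℝ) → ℝ) : Prop :=
  ∃ F : ℕ → (Fin m → ℝ) → ℝ, (∀ N, Continuous (F N)) ∧ (∃ C, ∀ N, ∀ y ∈ cube m, |F N y| ≤ C) ∧
    ∀ y ∈ cube m, Tendsto (fun N => F N y) atTop (𝓝 (f y))

namespace IsLim

variable {m : ℕ}

theorem of_continuous {f : (Fin m → ℝ) → ℝ} (hf : Continuous f) : IsLim f := by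
  obtain ⟨C, hC⟩ := (isCompact_cube m).exists_bound_of_continuousOn hf.continuousOn
  exact ⟨fun _ => f, fun _ => hf, ⟨C, fun _ => hC⟩, fun _ _ => tendsto_const_nhds⟩

theorem mul {f g : (Fin m → ℝ) → ℝ} (hf : IsLim f) (hg : IsLim g) : IsLim fun y => f y * g y := by
  obtain ⟨F, hF, ⟨C, hC⟩, hlim⟩ := hf
  obtain ⟨G, hG, ⟨D, hD⟩, hlim'⟩ := hg
  refine ⟨fun N y => F N y * G N y, fun N => (hF N).mul (hG N), ⟨C * D, fun N y hy => ?_⟩,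
    fun y hy => (hlim y hy).mul (hlim' y hy)⟩
  rw [abs_mul]
  exact mul_le_mul (hC N y hy) (hD N y hy) (abs_nonneg _) ((abs_nonneg _).trans (hC N y hy))

theorem one_sub {f : (Fin m → ℝ) → ℝ} (hf : IsLim f) : IsLim fun y => 1 - f y := by
  obtain ⟨F, hF, ⟨C, hC⟩, hlim⟩ := hf
  refine ⟨fun N y => 1 - F N y, fun N => continuous_const.sub (hF N), ⟨1 + C, fun N y hy => ?_⟩,
    fun y hy => (hlim y hy).const_sub 1⟩
  exact (abs_sub _ _).trans (by rw [abs_one]; exact add_le_add_right (hC N y hy) 1)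

theorem prod {ι : Type*} (s : Finset ι) {f : ι → (Fin m → ℝ) → ℝ} (hf : ∀ i, IsLim (f i)) :
    IsLim fun y => ∏ i ∈ s, f i y := by
  classical
  induction s using Finset.induction_on with
  | empty => simpa using of_continuous continuous_const
  | insert i s hi ih => simpa only [Finset.prod_insert hi] using (hf i).mul ih

open Classical in
/-- The indicator of the zero set of a continuous function. -/
theorem indicator {f : (Fin m → ℝ) → ℝ} (hf : Continuous f) :
    IsLim fun y => if f y = 0 then 1 else 0 := by
  -- Tents of height one that narrow onto the zero set as `N` grows.
  refine ⟨fun N y => max 0 (1 - N * |f y|), fun N => by fun_prop, ⟨1, fun N y _ => ?_⟩,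
    fun y _ => ?_⟩
  · have : 0 ≤ N * |f y| := by positivity
    rw [abs_of_nonneg (le_max_left _ _)]
    exact max_le zero_le_one (by linarith)
  · by_cases h : f y = 0
    · simp [h]
    · simp only [h, if_false]
      refine tendsto_const_nhds.congr' ?_
      obtain ⟨M, hM⟩ := exists_nat_gt (1 / |f y|)
      filter_upwards [eventually_ge_atTop M] with N hN
      have hpos := abs_pos.2 h
      have : 1 / |f y| < N := hM.trans_le (by exact_mod_cast hN)
      rw [div_lt_iff₀ hpos] at this
      rw [max_eq_left (by linarith)]

open Classical in
theorem indicator_iff {f : (Fin m → ℝ) → ℝ} (hf : Continuous f) (P : Prop) :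
    IsLim fun y => if f y = 0 ↔ P then 1 else 0 := by
  by_cases hP : P
  · simpa [hP] using indicator hf
  · convert (indicator hf).one_sub using 2 with y
    by_cases h : f y = 0 <;> simp [hP, h]

open Classical in
theorem indicator_forall {ι : Type*} [Fintype ι] {p : ι → (Fin m → ℝ) → Prop}
    (h : ∀ i, IsLim fun y => if p i y then 1 else 0) :
    IsLim fun y => if ∀ i, p i y then 1 else 0 := by
  convert prod Finset.univ h using 2 with y
  rw [Finset.prod_ite_zero]
  simp

end IsLim

end BetaBernoulli

/-! ### Test functions that separate chains -/

namespace BetaBernoulli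

variable {k : ℕ} {Δ : Fin k → ℕ} {n : ℕ}

open Filter Topology

namespace Blocks

variable {r m : ℕ}

open Classical in
/-- A test function that singles out the chain described by `l₀` and `ps₀`. -/
theorem exists_isLim_mean_eq {l₀ : Blocks r m} (hl₀ : l₀.Good) (ps₀ : Fin m → Fin n)
    {θ : Fin n → ℝ} (hθ : Function.Injective θ) : ∃ f : (Fin m → ℝ) → ℝ, IsLim f ∧
      ∀ (l : Blocks r m) (ps : Fin m → Fin n), l.Good → l.mean f (fun a => θ (ps a)) =
        if label l ps = label l₀ ps₀ ∧ ∀ c ∈ l, c ∈ l₀ then 1 else 0 := by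
  obtain ⟨f, hf, hdual⟩ := exists_dual_dens r
  let h (S : Finset (Fin m)) : ℝ → ℝ := if H : ∃ i, (i, S) ∈ l₀ then f H.choose else 0
  have hh (c) (hc : c ∈ l₀) : h c.2 = f c.1 := by
    have H : ∃ i, (i, c.2) ∈ l₀ := ⟨c.1, hc⟩
    simp only [h, dif_pos H]
    exact congrArg f (congrArg Prod.fst (hl₀.eq_of_snd_eq H.choose_spec hc rfl))
  have hcont (S) : Continuous (h S) := by
    simp only [h]
    split_ifs
    exacts [hf _, continuous_const]
  -- `I₁` tests the equalities among positions and `I₂` those with free parameters, which together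
  -- fix the labels. `P` then tests the Beta indices of the blocks through the dual functions.
  let I₁ (y : Fin m → ℝ) : ℝ :=
    if ∀ q : Fin m × Fin m, y q.1 - y q.2 = 0 ↔ label l₀ ps₀ q.1 = label l₀ ps₀ q.2 then 1 else 0
  let I₂ (y : Fin m → ℝ) : ℝ :=
    if ∀ q : Fin m × Fin n, y q.1 - θ q.2 = 0 ↔ label l₀ ps₀ q.1 = .inl q.2 then 1 else 0
  let P (y : Fin m → ℝ) : ℝ := (l₀.map fun c => h c.2 (rep c.2 y)).prod
  refine ⟨fun y => I₁ y * I₂ y * P y, ?_, fun l ps hl => ?_⟩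
  · refine (IsLim.mul ?_ ?_).mul (.of_continuous ?_)
    · convert IsLim.indicator_forall
        (p := fun (q : Fin m × Fin m) (y : Fin m → ℝ) =>
          y q.1 - y q.2 = 0 ↔ label l₀ ps₀ q.1 = label l₀ ps₀ q.2)
        fun q => by convert IsLim.indicator_iff (f := fun y => y q.1 - y q.2) (by fun_prop) _
    · convert IsLim.indicator_forall
        (p := fun (q : Fin m × Fin n) (y : Fin m → ℝ) =>
          y q.1 - θ q.2 = 0 ↔ label l₀ ps₀ q.1 = .inl q.2)
        fun q => by convert IsLim.indicator_iff (f := fun y => y q.1 - θ q.2) (by fun_prop) _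
    · exact continuous_list_prod _ fun c _ => (hcont c.2).comp (continuous_rep c.2)
  by_cases hlab : label l ps = label l₀ ps₀
  · rw [mean_congr (Finset.univ.image θ) (g := fun y => (l.map fun c => h c.2 (rep c.2 y)).prod),
      mean_prod hl]
    · have e (c) (hc : c ∈ l) : ∫ z in (0 : ℝ)..1, dens (c.1 + 1) (r - c.1) z * h c.2 z =
          if c ∈ l₀ then 1 else 0 := by
        have hc' := (map_snd_perm hl hl₀ hlab).subset (List.mem_map_of_mem hc)
        obtain ⟨d, hd, hdc⟩ := List.mem_map.1 hc'
        rw [← hdc, hh d hd, hdual]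
        refine if_congr ⟨fun hi => ?_, fun hc => ?_⟩ rfl rfl
        · rwa [show c = d from Prod.ext hi hdc.symm]
        · rw [hl₀.eq_of_snd_eq hc hd hdc.symm]
      rw [List.map_congr_left e]
      split_ifs with hc
      · exact List.prod_eq_one fun x hx => by
          obtain ⟨c, hcl, rfl⟩ := List.mem_map.1 hx
          exact if_pos (hc.2 c hcl)
      · rw [List.prod_eq_zero_iff, List.mem_map]
        have : ∃ c ∈ l, c ∉ l₀ := by
          by_contra! hcon
          exact hc ⟨hlab, hcon⟩
        obtain ⟨c, hcl, hc⟩ := this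
        exact ⟨c, hcl, if_neg hc⟩
    · intro y hy
      have h₁ : I₁ y = 1 := if_pos fun q => by
        rw [sub_eq_zero, ← hlab]
        exact hy.eq_iff hθ hl _ _
      have h₂ : I₂ y = 1 := if_pos fun q => by
        rw [sub_eq_zero, ← hlab]
        exact hy.eq_param_iff hθ hl _ _
      simp only [h₁, h₂, one_mul, P]
      have := ((map_snd_perm hl hl₀ hlab).map fun S => h S (rep S y)).prod_eq
      rw [List.map_map, List.map_map] at this
      exact this.symm
  · rw [if_neg fun hc => hlab hc.1,
      mean_congr (Finset.univ.image θ) (g := fun y => 0 * 0), mean_const_mul, zero_mul]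
    intro y hy
    rw [zero_mul]
    by_contra hne
    refine hlab (label_eq_of_iff hl hl₀ (fun a b => ?_) fun a p => ?_)
    · have h₁ : I₁ y ≠ 0 := fun e => hne (by simp [e])
      have := (ite_ne_right_iff.1 h₁).1 (a, b)
      rw [← this, sub_eq_zero, hy.eq_iff hθ hl]
    · have h₂ : I₂ y ≠ 0 := fun e => hne (by simp [e])
      have := (ite_ne_right_iff.1 h₂).1 (a, p)
      rw [← this, sub_eq_zero, hy.eq_param_iff hθ hl]

/-- Equal labels give equally many blocks, so containment is a permutation; binders commute, and the
values of `ps` inside blocks are never read. -/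
theorem chain_eq {x : Fin k} {l l₀ : Blocks r (Δ x)} (hl : l.Good) (hl₀ : l₀.Good)
    {ps ps₀ : Fin (Δ x) → Fin n} (h : label l ps = label l₀ ps₀)
    (hmem : ∀ c ∈ l, c ∈ l₀) : Cls.mk (.chain x l ps) = Cls.mk (.chain x l₀ ps₀) := by
  have hperm := map_snd_perm hl hl₀ h
  have hsub : l.Subperm l₀ := (hl.nodup_map_snd.of_map _).subperm hmem
  have hlen : l₀.length ≤ l.length := by simpa using hperm.length_eq.ge
  rw [Term.chain_perm (hsub.perm_of_length_le hlen) hl.disj]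
  congr 1
  refine Term.chain_congr fun a ha => ?_
  have : label l ps a = .inl (ps₀ a) := h ▸ label_eq_inl.2 ⟨ha, rfl⟩
  exact (label_eq_inl.1 this).2

end Blocks

namespace Cls

/-- Expected values of continuous test functions. -/
noncomputable def eval (c : Cls Δ n) (g : Test Δ) (θ : Fin n → ℝ) : ℝ := c.out.eval g θ

theorem eval_mk (t : Term Δ n) {g : Test Δ} (hg : ∀ x, Continuous (g x)) (θ : Fin n → ℝ) :
    (mk t).eval g θ = t.eval g θ :=
  (mk_eq.1 (Quotient.out_eq (mk t))).eval_eq hg θ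

-- The separating function for `c₀` is only a limit, so it is approximated by continuous test
-- functions on the variable of `c₀`, extended by zero to the other variables; dominated convergence
-- passes the limit through the Beta integrals.
open Classical in
theorem exists_test {r : ℕ} {c₀ : Cls Δ (n + 1)} (h₀ : IsChain r c₀) {θ : Fin (n + 1) → ℝ}
    (hθ : Function.Injective θ) (hθ' : θ ∈ cube (n + 1)) :
    ∃ g : ℕ → Test Δ, (∀ N x, Continuous (g N x)) ∧ ∀ c, IsChain r c →
      Tendsto (fun N => c.eval (g N) θ) atTop (𝓝 (if c = c₀ then 1 else 0)) := by
  obtain ⟨x₀, l₀, ps₀, hl₀, -, rfl⟩ := h₀.exists_eq_chain 0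
  obtain ⟨f, ⟨F, hF, ⟨C, hC⟩, hlim⟩, hf⟩ := Blocks.exists_isLim_mean_eq hl₀ ps₀ hθ
  let g (N : ℕ) : Test Δ := Function.update (fun _ _ => 0) x₀ (F N)
  have hg (N x) : Continuous (g N x) := by
    by_cases hx : x = x₀
    · subst hx
      simpa [g] using hF N
    · simpa [g, Function.update_of_ne hx] using continuous_const
  have key (l : Blocks r (Δ x₀)) (ps : Fin (Δ x₀) → Fin (n + 1)) :
      Tendsto (fun N => (mk (.chain x₀ l ps)).eval (g N) θ) atTop
        (𝓝 (l.mean f fun a => θ (ps a))) := by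
    simp only [eval_mk _ (hg _), Term.eval_chain, g, Function.update_self]
    exact Blocks.tendsto_mean hF hC hlim l fun a _ => hθ' _ trivial
  have h₁ : Tendsto (fun N => (mk (.chain x₀ l₀ ps₀)).eval (g N) θ) atTop (𝓝 1) := by
    have := key l₀ ps₀
    rwa [hf l₀ ps₀ hl₀, if_pos ⟨rfl, fun _ h => h⟩] at this
  refine ⟨g, hg, fun c hc => ?_⟩
  suffices c = mk (.chain x₀ l₀ ps₀) ∨ Tendsto (fun N => c.eval (g N) θ) atTop (𝓝 0) by
    split_ifs with h
    · rwa [h]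
    · exact this.resolve_left h
  obtain ⟨x, l, ps, hl, -, rfl⟩ := hc.exists_eq_chain 0
  by_cases hx : x = x₀
  · subst hx
    by_cases h : Blocks.label l ps = Blocks.label l₀ ps₀ ∧ ∀ c ∈ l, c ∈ l₀
    · exact .inl (Blocks.chain_eq hl hl₀ h.1 h.2)
    · have := key l ps
      rw [hf l ps hl, if_neg h] at this
      exact .inr this
  · refine .inr (tendsto_const_nhds.congr fun N => ?_)
    have := Blocks.mean_const_mul 0 (fun _ => 0) l fun a => θ (ps a)
    rw [zero_mul, zero_mul] at this
    rw [eval_mk _ (hg N), Term.eval_chain, ← this]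
    simp [g, Function.update_of_ne hx]

variable {g : Test Δ} (θ : Fin n → ℝ)

theorem eval_get (hg : ∀ x, Continuous (g x)) (p : Fin n) (a b : Cls Δ n) :
    (get p a b).eval g θ = θ p * a.eval g θ + (1 - θ p) * b.eval g θ := by
  induction a, b using Quotient.inductionOn₂ with | _ a b
  exact (eval_mk _ hg θ).trans (by rw [eval_mk a hg, eval_mk b hg]; rfl)

theorem eval_ch (hg : ∀ x, Continuous (g x)) {i j : ℕ} (h : 0 < i + j) (a b : Cls Δ n) :
    (ch i j a b).eval g θ = (i * a.eval g θ + j * b.eval g θ) / (i + j) := by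
  induction a, b using Quotient.inductionOn₂ with | _ a b
  rw [ch_mk h, eval_mk _ hg, eval_mk a hg, eval_mk b hg]
  rfl

theorem IsMix.eval_eq (hg : ∀ x, Continuous (g x)) {s : Multiset (Cls Δ n)} {a : Cls Δ n}
    (h : IsMix s a) : a.eval g θ = (s.map fun c => c.eval g θ).sum / s.card := by
  induction h with
  | single a => simp
  | add hs ht ihs iht =>
    have h₁ : (0 : ℝ) < _ := Nat.cast_pos.2 hs.card_pos
    have h₂ : (0 : ℝ) < _ := Nat.cast_pos.2 ht.card_pos
    rw [eval_ch θ hg (Nat.add_pos_left hs.card_pos _), ihs, iht, Multiset.map_add,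
      Multiset.sum_add, Multiset.card_add, Nat.cast_add]
    field_simp

end Cls

end BetaBernoulli

/-! ### Recovering the leaves of a tree, and completeness -/

namespace BetaBernoulli

variable {k : ℕ} {Δ : Fin k → ℕ} {n : ℕ}

open Filter Topology
open Finsupp (single)

/-- The expected value at the leaves of a tree of draws. -/
noncomputable def drawMean : List (Fin n) → ((Fin n →₀ ℕ) → ℝ) → (Fin n → ℝ) → ℝ
  | [], W, _ => W 0
  | p :: l, W, θ =>
    θ p * drawMean l (fun k => W (k + single p 1)) θ + (1 - θ p) * drawMean l W θ

/-- `drawMean` as a polynomial in the odds `θ / (1 - θ)`, up to a factor. -/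
noncomputable def drawPoly : List (Fin n) → ((Fin n →₀ ℕ) → ℝ) → MvPolynomial (Fin n) ℝ
  | [], W => .C (W 0)
  | p :: l, W => .X p * drawPoly l (fun k => W (k + single p 1)) + drawPoly l W

theorem tendsto_drawMean {l : List (Fin n)} {W : ℕ → (Fin n →₀ ℕ) → ℝ} {V : (Fin n →₀ ℕ) → ℝ}
    (h : ∀ k, Tendsto (fun N => W N k) atTop (𝓝 (V k))) (θ : Fin n → ℝ) :
    Tendsto (fun N => drawMean l (W N) θ) atTop (𝓝 (drawMean l V θ)) := by
  induction l generalizing W V with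
  | nil => exact h 0
  | cons p l ih => exact ((ih fun k => h _).const_mul _).add ((ih h).const_mul _)

theorem eval_drawPoly (l : List (Fin n)) (W : (Fin n →₀ ℕ) → ℝ) {s : Fin n → ℝ}
    (hs : ∀ p, 0 < s p) : (drawPoly l W).eval s =
      (l.map fun p => 1 + s p).prod * drawMean l W fun p => s p / (1 + s p) := by
  induction l generalizing W with
  | nil => simp [drawPoly, drawMean]
  | cons p l ih =>
    have := hs p
    simp only [drawPoly, drawMean, map_add, map_mul, MvPolynomial.eval_X, ih, List.map_cons,
      List.prod_cons]
    field_simp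
    ring

/-- The weight `w k` counts the outcomes of the draws with success numbers `k`; it is positive as
soon as `k` can occur. -/
theorem exists_coeff_drawPoly (l : List (Fin n)) : ∃ w : (Fin n →₀ ℕ) → ℝ, (∀ k, 0 ≤ w k) ∧
    (∀ k : Fin n →₀ ℕ, (∀ p, k p ≤ l.count p) → 0 < w k) ∧
    ∀ W k, (drawPoly l W).coeff k = w k * W k := by
  induction l with
  | nil =>
    refine ⟨fun k => if k = 0 then 1 else 0, fun k => by positivity, fun k hk => ?_, fun W k => ?_⟩
    · have h0 : k = 0 := Finsupp.ext fun p => by simpa using hk p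
      simp [h0]
    · rw [drawPoly, MvPolynomial.coeff_C]
      by_cases h : k = 0
      · simp [h]
      · simp [h, Ne.symm h]
  | cons p l ih =>
    obtain ⟨w, hw, hpos, hcoeff⟩ := ih
    refine ⟨fun k => (if p ∈ k.support then w (k - single p 1) else 0) + w k, fun k => ?_,
      fun k hk => ?_, fun W k => ?_⟩
    · have := hw k
      have := hw (k - single p 1)
      positivity
    · by_cases h : k p ≤ l.count p
      · refine add_pos_of_nonneg_of_pos ?_ (hpos k fun q => ?_)
        · have := hw (k - single p 1)
          positivity
        · by_cases hq : q = p
          · rwa [hq]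
          · simpa [List.count_cons_of_ne (Ne.symm hq)] using hk q
      · refine add_pos_of_pos_of_nonneg ?_ (hw k)
        rw [if_pos (Finsupp.mem_support_iff.2 (by omega))]
        refine hpos _ fun q => ?_
        have := hk q
        by_cases hq : q = p
        · subst hq
          rw [List.count_cons_self] at this
          simp only [Finsupp.tsub_apply, Finsupp.single_eq_same]
          omega
        · rw [List.count_cons_of_ne (Ne.symm hq)] at this
          exact (Nat.sub_le _ _).trans this
    · rw [drawPoly, MvPolynomial.coeff_add, MvPolynomial.coeff_X_mul', hcoeff, hcoeff, add_mul]
      congr 1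
      split_ifs with h
      · rw [tsub_add_cancel_of_le]
        exact Finsupp.single_le_iff.2 (Nat.pos_of_ne_zero (Finsupp.mem_support_iff.1 h))
      · rw [zero_mul]

/-- The values at the leaves are determined by the expected values for all distinct parameters. -/
theorem eq_of_drawMean_eq {l : List (Fin n)} {W V : (Fin n →₀ ℕ) → ℝ}
    (h : ∀ θ ∈ cube n, Function.Injective θ → drawMean l W θ = drawMean l V θ)
    {k : Fin n →₀ ℕ} (hk : ∀ p, k p ≤ l.count p) : W k = V k := by
  obtain ⟨w, -, hpos, hcoeff⟩ := exists_coeff_drawPoly l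
  have e : drawPoly l W = drawPoly l V := by
    -- Infinite sets of odds suffice for a polynomial identity, and the disjoint intervals `(p, p +
    -- 1)` force the parameter values to be distinct.
    refine MvPolynomial.funext_set (fun p : Fin n => Set.Ioo (p : ℝ) (p + 1))
      (fun p => Set.Ioo_infinite (by linarith)) fun s hs => ?_
    have hs₀ (p) : 0 < s p := (Nat.cast_nonneg _).trans_lt (hs p trivial).1
    have hfloor (p) : ⌊s p⌋₊ = p :=
      (Nat.floor_eq_iff (hs₀ p).le).2 ⟨(hs p trivial).1.le, (hs p trivial).2⟩
    rw [eval_drawPoly l W hs₀, eval_drawPoly l V hs₀, h]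
    · intro p _
      have := hs₀ p
      exact ⟨by positivity, by rw [div_le_one (by positivity)]; linarith⟩
    · intro p q hpq
      have := hs₀ p
      have := hs₀ q
      have hpq : s p = s q := by
        field_simp at hpq
        linarith
      exact Fin.ext (by rw [← hfloor p, ← hfloor q, hpq])
  have := congrArg (MvPolynomial.coeff k) e
  rw [hcoeff, hcoeff] at this
  exact mul_left_cancel₀ (hpos k hk).ne' this

namespace Cls

theorem eval_tree {g : Test Δ} (hg : ∀ x, Continuous (g x)) (θ : Fin n → ℝ) (l : List (Fin n))
    (L : (Fin n →₀ ℕ) → Cls Δ n) :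
    (tree l L).eval g θ = drawMean l (fun k => (L k).eval g θ) θ := by
  induction l generalizing L with
  | nil => rfl
  | cons p l ih => rw [tree, eval_get θ hg, ih, ih, drawMean]

open Classical in
theorem IsMix.tendsto_eval {s : Multiset (Cls Δ n)} {a c₀ : Cls Δ n} (h : IsMix s a)
    {g : ℕ → Test Δ} (hg : ∀ N x, Continuous (g N x)) {θ : Fin n → ℝ}
    (hs : ∀ c ∈ s, Tendsto (fun N => c.eval (g N) θ) atTop (𝓝 (if c = c₀ then 1 else 0))) :
    Tendsto (fun N => a.eval (g N) θ) atTop (𝓝 (s.count c₀ / s.card)) := by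
  simp only [h.eval_eq θ (hg _)]
  refine Tendsto.div_const ?_ _
  clear h
  induction s using Multiset.induction_on with
  | empty => simp
  | cons c s ih =>
    simp only [Multiset.map_cons, Multiset.sum_cons]
    convert (hs c (by simp)).add (ih fun d hd => hs d (by simp [hd])) using 2
    rw [Multiset.count_cons]
    split_ifs with h₁ h₂ h₂
    · push_cast
      ring
    · exact absurd h₁.symm h₂
    · exact absurd h₂.symm h₁
    · simp

/-- Completeness: terms with the same expected values are derivably equal. -/
theorem eq_of_eval_eq {a b : Cls Δ (n + 1)}
    (h : ∀ g : Test Δ, (∀ x, Continuous (g x)) → ∀ θ ∈ cube (n + 1), a.eval g θ = b.eval g θ) :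
    a = b := by
  classical
  obtain ⟨N, hN⟩ := exists_eq_tree a
  obtain ⟨N', hN'⟩ := exists_eq_tree b
  -- Common data for both normal forms: every parameter is drawn `N + N'` times, and `r = N + N'`.
  obtain ⟨l, hl⟩ : ∃ l : List (Fin (n + 1)), ∀ p, l.count p = N + N' := by
    refine ⟨(List.replicate (N + N') (List.finRange (n + 1))).flatten, fun p => ?_⟩
    rw [List.count_flatten, List.map_replicate, List.sum_replicate,
      List.count_eq_one_of_mem (List.nodup_finRange _) (List.mem_finRange p), smul_eq_mul, mul_one]
  obtain ⟨L, hL, rfl⟩ := hN l (fun p => by rw [hl]; omega) (N + N') (by omega)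
  obtain ⟨L', hL', rfl⟩ := hN' l (fun p => by rw [hl]; omega) (N + N') (by omega)
  choose s hs hchain using hL
  choose s' hs' hchain' using hL'
  -- The mixtures at a leaf agree once every class has the same frequency in both; only chains occur
  -- in them.
  refine tree_congr fun k hk => (hs k).eq_of_smul_eq (hs' k) (Multiset.ext.2 fun c₀ => ?_)
  rw [Multiset.count_nsmul, Multiset.count_nsmul]
  by_cases h₀ : IsChain (N + N') c₀
  · have key : ((s k).count c₀ / (s k).card : ℝ) = (s' k).count c₀ / (s' k).card := by
      refine eq_of_drawMean_eq (W := fun k => ((s k).count c₀ / (s k).card : ℝ))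
        (V := fun k => ((s' k).count c₀ / (s' k).card : ℝ)) (fun θ hθ hinj => ?_) hk
      obtain ⟨g, hg, hlim⟩ := exists_test h₀ hinj hθ
      have h₁ := tendsto_drawMean (l := l) (fun k => (hs k).tendsto_eval hg
        fun c hc => hlim c (hchain k c hc)) θ
      have h₂ := tendsto_drawMean (l := l) (fun k => (hs' k).tendsto_eval hg
        fun c hc => hlim c (hchain' k c hc)) θ
      refine tendsto_nhds_unique h₁ (h₂.congr fun m => ?_)
      rw [← eval_tree (hg m), ← eval_tree (hg m), h (g m) (hg m) θ hθ]
    have p₁ : ((s k).card : ℝ) ≠ 0 := by exact_mod_cast (hs k).card_pos.ne'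
    have p₂ : ((s' k).card : ℝ) ≠ 0 := by exact_mod_cast (hs' k).card_pos.ne'
    rw [div_eq_div_iff p₁ p₂] at key
    have key' : (s k).count c₀ * (s' k).card = (s' k).count c₀ * (s k).card := by exact_mod_cast key
    rw [mul_comm, key', mul_comm]
  · rw [Multiset.count_eq_zero_of_notMem fun hc => h₀ (hchain k c₀ hc),
      Multiset.count_eq_zero_of_notMem fun hc => h₀ (hchain' k c₀ hc), mul_zero, mul_zero]

end Cls

/-- If the integrals against all Beta distributions agree, then so do the expected values. -/
theorem Term.eval_eq_of_nu {t u : Term Δ (n + 1)}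
    (h : ∀ (i j : ℕ) (hi : 0 < i) (hj : 0 < j), Derivable (.nu i j hi hj t) (.nu i j hi hj u))
    {g : Test Δ} (hg : ∀ x, Continuous (g x)) {θ : Fin (n + 1) → ℝ} (hθ : θ ∈ cube (n + 1)) :
    t.eval g θ = u.eval g θ := by
  let f (t : Term Δ (n + 1)) (z : ℝ) : ℝ := t.eval g (Fin.cons z (Fin.tail θ))
  have hf (t) : Continuous (f t) :=
    (t.continuous_eval hg).comp (Continuous.finCons continuous_id continuous_const)
  have e (t) : t.eval g θ = f t (θ 0) := by simp only [f, Fin.cons_self_tail]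
  have key := eq_zero_of_moments ((hf t).sub (hf u)) (fun a => ?_) (hθ 0 trivial)
  · rw [e, e]
    exact sub_eq_zero.1 key
  -- The density with indices `(a + 1, 1)` is `z ^ a` up to a constant, so it gives the moment of
  -- order `a`.
  have h₁ := (h (a + 1) 1 a.succ_pos one_pos).eval_eq hg (Fin.tail θ)
  have h₂ (t) : Continuous fun z => dens (a + 1) 1 z * f t z := (continuous_dens _ _).mul (hf t)
  have h₃ : ∫ z in (0 : ℝ)..1, dens (a + 1) 1 z * (f t z - f u z) = 0 := by
    simp only [mul_sub]
    rw [intervalIntegral.integral_sub ((h₂ t).intervalIntegrable _ _)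
      ((h₂ u).intervalIntegrable _ _)]
    exact sub_eq_zero.2 h₁
  have h₄ (z : ℝ) : z ^ a * (f t z - f u z) =
      betaInt a 0 * (dens (a + 1) 1 z * (f t z - f u z)) := by
    have := (betaInt_pos a 0).ne'
    simp only [dens, Nat.add_sub_cancel, Nat.sub_self, pow_zero, mul_one]
    field_simp
  simp only [Pi.sub_apply, h₄]
  rw [intervalIntegral.integral_const_mul, h₃, mul_zero]

end BetaBernoulli

theorem mainTheorem4 {k : ℕ} (Δ : Fin k → ℕ) (n : ℕ) (t u : BetaBernoulli.Term Δ (n + 1))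
    (h : ∀ (i j : ℕ) (hi : 0 < i) (hj : 0 < j),
      BetaBernoulli.Derivable (BetaBernoulli.Term.nu i j hi hj t)
        (BetaBernoulli.Term.nu i j hi hj u)) :
    BetaBernoulli.Derivable t u := by
  refine BetaBernoulli.Cls.mk_eq.1 (BetaBernoulli.Cls.eq_of_eval_eq fun g hg θ hθ => ?_)
  rw [BetaBernoulli.Cls.eval_mk t hg, BetaBernoulli.Cls.eval_mk u hg]
  exact BetaBernoulli.Term.eval_eq_of_nu h hg hθ
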